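/- Let $(\mathbb D,<)$ be an infinite linearly ordered set. A data word over a finite alphabet $\mathbb A$ is a finite non-empty sequence $w=(a_1,d_1)\cdots(a_n,d_n)$ with $a_i\in\mathbb A$ and $d_i\in\mathbb D$. The formulas of $\mathit{ord}\text{-}\mathsf{LTL}^{\downarrow}_{\mathsf{nnf}}(\mathfrak F,\exists_\ge^\downarrow,\forall_\le^\downarrow)$ over $\mathbb A$ are given by $$\varphi ::= a \mid \neg a \mid {\uparrow} \mid \neg{\uparrow} \mid {\uparrow_>} \mid {\uparrow_<} \mid {\downarrow}\varphi \mid \mathsf X\varphi \mid \bar{\mathsf X}\varphi \mid \mathsf U(\varphi,\varphi) \mid \bar{\mathsf U}(\varphi,\varphi) \mid \exists_\ge^\downarrow\varphi \mid \forall_\le^\downarrow\varphi \mid \varphi\wedge\varphi \mid \varphi\vee\varphi \qquad (a\in\mathbb A).$$ Satisfaction $(w,i)\models^d\varphi$ at a position $1\le i\le n$ with register value $d\in\mathbb D$ is defined as follows, $\wedge$ and $\vee$ being interpreted as usual: - $(w,i)\models^d a$ iff $a_i=a$, and $(w,i)\models^d\neg a$ iff $a_i\ne a$; - $(w,i)\models^d{\uparrow}$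 (resp. $\neg{\uparrow}$, ${\uparrow_>}$, ${\uparrow_<}$) iff $d=d_i$ (resp. $d\neq d_i$, $d>d_i$, $d<d_i$); - $(w,i)\models^d{\downarrow}\varphi$ iff $(w,i)\models^{d_i}\varphi$; - $(w,i)\models^d\mathsf X\varphi$ iff $i<n$ and $(w,i+1)\models^d\varphi$; - $(w,i)\models^d\bar{\mathsf X}\varphi$ iff $i=n$ or $(w,i+1)\models^d\varphi$; - $(w,i)\models^d\mathsf U(\varphi,\psi)$ iff there is $j$ with $i\le j\le n$, $(w,j)\models^d\varphi$, and $(w,k)\models^d\psi$ for all $i\le k<j$; - $(w,i)\models^d\bar{\mathsf U}(\varphi,\psi)$ iff for all $j$ with $i\le j\le n$, $(w,j)\models^d\varphi$ or $(w,k)\models^d\psi$ for some $i\le k<j$; - $(w,i)\models^d\exists_\ge^\downarrow\varphi$ iff $(w,i)\models^{d_j}\varphi$ for some $i\le j\le n$; - $(w,i)\models^d\forall_\le^\downarrow\varphi$ iff $(w,i)\models^{d_j}\varphi$ for all $1\le j\le i$. A formula $\varphi$ is satisfiable over $\mathbb D$ if there is a data word $w$ with $(w,1)\models^{d_1}\varphi$.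 Proposition. The following problem is decidable: given a finite alphabet $\mathbb A$ and a formula $\varphi$ of $\mathit{ord}\text{-}\mathsf{LTL}^{\downarrow}_{\mathsf{nnf}}(\mathfrak F,\exists_\ge^\downarrow,\forall_\le^\downarrow)$ over $\mathbb A$, is $\varphi$ satisfiable over $\mathbb D$? -/

import Mathlib

/-! Linear temporal logic with one register over finite data words whose data values come from a
linearly ordered domain: negation normal form, all forward modalities, and the two quantifiers
over data values (existential over the future, universal over the past). -/

/-- Formulas of the logic over the alphabet `A`, in negation normal form. -/
inductive OrdLTL (A : Type) : Type
  /-- the letter test `a` -/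
  | letter (a : A) : OrdLTL A
  /-- the negated letter test `¬ a` -/
  | negLetter (a : A) : OrdLTL A
  /-- `↑`: the register equals the current datum -/
  | testEq : OrdLTL A
  /-- `¬ ↑`: the register differs from the current datum -/
  | testNe : OrdLTL A
  /-- `↑>`: the register is greater than the current datum -/
  | testGt : OrdLTL A
  /-- `↑<`: the register is smaller than the current datum -/
  | testLt : OrdLTL A
  /-- `↓ φ`: store the current datum in the register -/
  | freeze (φ : OrdLTL A) : OrdLTL A
  /-- `X φ` (next) -/
  | next (φ : OrdLTL A) : OrdLTL A
  /-- the dual of `X φ` (weak next) -/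
  | dualNext (φ : OrdLTL A) : OrdLTL A
  /-- `U(φ, ψ)`: eventually `φ`, and `ψ` at all positions before that -/
  | untl (φ ψ : OrdLTL A) : OrdLTL A
  /-- the dual of `U(φ, ψ)` -/
  | dualUntl (φ ψ : OrdLTL A) : OrdLTL A
  /-- `∃≥↓ φ`: for some datum at the current or a later position -/
  | existsGe (φ : OrdLTL A) : OrdLTL A
  /-- `∀≤↓ φ`: for every datum at the current or an earlier position -/
  | forallLe (φ : OrdLTL A) : OrdLTL A
  | conj (φ ψ : OrdLTL A) : OrdLTL A
  | disj (φ ψ : OrdLTL A) : OrdLTL A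

/-- A (finite, non-empty) data word over the alphabet `A` and the data domain `D`: its positions
are the elements of `Fin (n + 1)`, the first one being `0`. -/
structure DataWord (A D : Type*) where
  n : ℕ
  letter : Fin (n + 1) → A
  datum : Fin (n + 1) → D

namespace OrdLTL

/-- `Holds w φ i d`: the formula `φ` holds in the data word `w` at position `i` when the register
contains `d`. -/
def Holds {A : Type} {D : Type*} [LinearOrder D] (w : DataWord A D) :
    OrdLTL A → Fin (w.n + 1) → D → Prop
  | letter a, i, _ => w.letter i = a
  | negLetter a, i, _ => ¬ w.letter i = a
  | testEq, i, d => d = w.datum i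
  | testNe, i, d => ¬ d = w.datum i
  | testGt, i, d => d > w.datum i
  | testLt, i, d => d < w.datum i
  | freeze φ, i, _ => Holds w φ i (w.datum i)
  | next φ, i, d => ∃ j : Fin (w.n + 1), j.val = i.val + 1 ∧ Holds w φ j d
  | dualNext φ, i, d => ∀ j : Fin (w.n + 1), j.val = i.val + 1 → Holds w φ j d
  | untl φ ψ, i, d => ∃ j, i ≤ j ∧ Holds w φ j d ∧ ∀ k, i ≤ k → k < j → Holds w ψ k d
  | dualUntl φ ψ, i, d => ∀ j, i ≤ j → Holds w φ j d ∨ ∃ k, i ≤ k ∧ k < j ∧ Holds w ψ k d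
  | existsGe φ, i, _ => ∃ j, i ≤ j ∧ Holds w φ i (w.datum j)
  | forallLe φ, i, _ => ∀ j, j ≤ i → Holds w φ i (w.datum j)
  | conj φ ψ, i, d => Holds w φ i d ∧ Holds w ψ i d
  | disj φ ψ, i, d => Holds w φ i d ∨ Holds w ψ i d

/-- `φ` is satisfiable over `D`: some data word with data in `D` satisfies it, evaluated at the
first position with the first datum in the register. -/
def Satisfiable {A : Type} (D : Type*) [LinearOrder D] (φ : OrdLTL A) : Prop :=
  ∃ w : DataWord A D, Holds w φ 0 (w.datum 0)

/-! Formulas as finite inputs of algorithms: an explicit numbering of the formulas over the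
alphabet with `k` letters. It is a bijection onto the natural numbers. -/

/-- The number of a formula over the alphabet `Fin k`. -/
def code {k : ℕ} : OrdLTL (Fin k) → ℕ
  | letter a => a
  | negLetter a => k + a
  | testEq => 2 * k
  | testNe => 2 * k + 1
  | testGt => 2 * k + 2
  | testLt => 2 * k + 3
  | freeze φ => 2 * k + 4 + (9 * code φ)
  | next φ => 2 * k + 4 + (9 * code φ + 1)
  | dualNext φ => 2 * k + 4 + (9 * code φ + 2)
  | existsGe φ => 2 * k + 4 + (9 * code φ + 3)
  | forallLe φ => 2 * k + 4 + (9 * code φ + 4)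
  | untl φ ψ => 2 * k + 4 + (9 * Nat.pair (code φ) (code ψ) + 5)
  | dualUntl φ ψ => 2 * k + 4 + (9 * Nat.pair (code φ) (code ψ) + 6)
  | conj φ ψ => 2 * k + 4 + (9 * Nat.pair (code φ) (code ψ) + 7)
  | disj φ ψ => 2 * k + 4 + (9 * Nat.pair (code φ) (code ψ) + 8)

theorem code_injective {k : ℕ} : Function.Injective (code (k := k)) := by
  intro φ
  induction φ with
  | letter a =>
    intro ψ h
    have := a.isLt
    cases ψ <;> simp only [code] at h <;> first | (congr 1; ext; omega) | omega
  | negLetter a =>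
    intro ψ h
    have := a.isLt
    cases ψ <;> simp only [code] at h <;> first | (congr 1; ext; omega) | omega
  | testEq | testNe | testGt | testLt =>
    intro ψ h
    cases ψ <;> simp only [code] at h <;> first | rfl | omega
  | freeze φ ih | next φ ih | dualNext φ ih | existsGe φ ih | forallLe φ ih =>
    intro ψ h
    cases ψ <;> simp only [code] at h <;> first | (congr 1; exact ih (by omega)) | omega
  | untl φ φ' ih ih' | dualUntl φ φ' ih ih' | conj φ φ' ih ih' | disj φ φ' ih ih' =>
    intro ψ h
    cases ψ <;> simp only [code] at h <;> first
      | omega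
      | (rename_i χ χ'
         have h2 := Nat.pair_eq_pair.1
           (show Nat.pair (code φ) (code φ') = Nat.pair (code χ) (code χ') by omega)
         rw [ih h2.1, ih' h2.2])

theorem code_surjective {k : ℕ} : Function.Surjective (code (k := k)) := by
  intro n
  induction n using Nat.strong_induction_on with
  | _ n ih =>
    by_cases h1 : n < k
    · exact ⟨letter ⟨n, h1⟩, rfl⟩
    by_cases h2 : n < 2 * k
    · exact ⟨negLetter ⟨n - k, by omega⟩, by simp only [code]; omega⟩
    by_cases h3 : n < 2 * k + 4
    · obtain h | h | h | h :
        n = 2 * k ∨ n = 2 * k + 1 ∨ n = 2 * k + 2 ∨ n = 2 * k + 3 := by omega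
      · exact ⟨testEq, h.symm⟩
      · exact ⟨testNe, h.symm⟩
      · exact ⟨testGt, h.symm⟩
      · exact ⟨testLt, h.symm⟩
    obtain ⟨m, hm⟩ : ∃ m, m = (n - (2 * k + 4)) / 9 := ⟨_, rfl⟩
    obtain ⟨φ, hφ⟩ := ih m (by omega)
    obtain ⟨φ₁, h₁⟩ := ih m.unpair.1 (lt_of_le_of_lt (Nat.unpair_left_le m) (by omega))
    obtain ⟨φ₂, h₂⟩ := ih m.unpair.2 (lt_of_le_of_lt (Nat.unpair_right_le m) (by omega))
    have hp : Nat.pair (code φ₁) (code φ₂) = m := by rw [h₁, h₂, Nat.pair_unpair]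
    obtain ⟨r, hr⟩ : ∃ r, r = (n - (2 * k + 4)) % 9 := ⟨_, rfl⟩
    have hr9 : r < 9 := by omega
    interval_cases r
    · exact ⟨freeze φ, by simp only [code]; omega⟩
    · exact ⟨next φ, by simp only [code]; omega⟩
    · exact ⟨dualNext φ, by simp only [code]; omega⟩
    · exact ⟨existsGe φ, by simp only [code]; omega⟩
    · exact ⟨forallLe φ, by simp only [code]; omega⟩
    · exact ⟨untl φ₁ φ₂, by simp only [code]; omega⟩
    · exact ⟨dualUntl φ₁ φ₂, by simp only [code]; omega⟩
    · exact ⟨conj φ₁ φ₂, by simp only [code]; omega⟩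
    · exact ⟨disj φ₁ φ₂, by simp only [code]; omega⟩

/-- The numbering `code` makes formulas over `Fin k` inputs of computable functions. -/
noncomputable instance instDenumerable (k : ℕ) : Denumerable (OrdLTL (Fin k)) :=
  Denumerable.mk' (Equiv.ofBijective code ⟨code_injective, code_surjective⟩)

/-- An instance of the satisfiability problem: the size `k` of the alphabet `Fin k`, and a formula
over it. Its code is the pair of `k` and the number of the formula. -/
abbrev Instance : Type := Σ k : ℕ, OrdLTL (Fin k)

theorem encode_instance (k : ℕ) (φ : OrdLTL (Fin k)) :
    @Encodable.encode Instance Primcodable.toEncodable ⟨k, φ⟩ = Nat.pair k φ.code := rfl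

end OrdLTL

/-! By Post's theorem it is enough that satisfiability and unsatisfiability are both recursively
enumerable. Each is witnessed by finite certificates that a primitive recursive predicate checks.

All modalities look forward, so the truth of a formula depends only on the rest of the word, the
register and the set `P` of earlier data (`Sat`). In negation normal form `P` occurs only in the
range of a universal quantifier, so satisfaction is antitone in `P` (`Sat.anti`). A configuration
lists, in the order of the data, demands on finitely many data, and `P` is taken to be the set of
data demanded to be past. Forgetting a datum drops demands and shrinks `P`. Hence realizable
configurations are closed under sublists (`Realizes.sublist`), and by Higman's lemma
(`exists_finite_basis`) the unrealizable ones with bounded labels have a finite basis.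

Consecutive positions are linked by a list of items subject to the local, tableau-like conditions
`Valid`. A realizing word yields such a list of bounded length, with next labels realized by the
rest of the word (`exists_valid`). Conversely, such a list carries realizability back from the next
labels (`realizes_of_valid_true`) or starts it at the last position (`realizes_of_valid_false`).
Values are thus assigned from the end of the word backwards: any increasing chain serves at the last
position, and earlier positions only forget data. So `D` needs only arbitrarily long finite chains,
not density, and the certificates do not mention `D`.

Satisfiability is certified by ranked configurations whose steps lower the rank, unsatisfiability by
a finite set whose upward closure is closed under steps and allows no word to end. -/

namespace OrdLTL

/-! ### Satisfaction in terms of the rest of the word and the set of past data -/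

section Suffix

variable {A D : Type*}

/-- The unfolding of `U(φ, ψ)` along a word given by its first position, its other positions and
the set of the earlier data. -/
def untilRec (Φ Ψ : A × D → List (A × D) → Set D → Prop) : A × D → List (A × D) → Set D → Prop
  | x, [], P => Φ x [] P
  | x, y :: u, P => Φ x (y :: u) P ∨ (Ψ x (y :: u) P ∧ untilRec Φ Ψ y u (insert x.2 P))

/-- The unfolding of the dual of `U(φ, ψ)`. -/
def dualUntilRec (Φ Ψ : A × D → List (A × D) → Set D → Prop) :
    A × D → List (A × D) → Set D → Prop
  | x, [], P => Φ x [] P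
  | x, y :: u, P => Φ x (y :: u) P ∧ (Ψ x (y :: u) P ∨ dualUntilRec Φ Ψ y u (insert x.2 P))

theorem untilRec_mono {Φ Ψ Φ' Ψ' : A × D → List (A × D) → Set D → Prop}
    (hΦ : ∀ x u P Q, P ⊆ Q → Φ x u Q → Φ' x u P) (hΨ : ∀ x u P Q, P ⊆ Q → Ψ x u Q → Ψ' x u P)
    (u : List (A × D)) : ∀ x P Q, P ⊆ Q → untilRec Φ Ψ x u Q → untilRec Φ' Ψ' x u P := by
  induction u with
  | nil => exact fun x P Q h => hΦ x [] P Q h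
  | cons y u ih =>
    exact fun x P Q h => Or.imp (hΦ _ _ _ _ h)
      (And.imp (hΨ _ _ _ _ h) (ih _ _ _ (Set.insert_subset_insert h)))

theorem dualUntilRec_mono {Φ Ψ Φ' Ψ' : A × D → List (A × D) → Set D → Prop}
    (hΦ : ∀ x u P Q, P ⊆ Q → Φ x u Q → Φ' x u P) (hΨ : ∀ x u P Q, P ⊆ Q → Ψ x u Q → Ψ' x u P)
    (u : List (A × D)) : ∀ x P Q, P ⊆ Q → dualUntilRec Φ Ψ x u Q → dualUntilRec Φ' Ψ' x u P := by
  induction u with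
  | nil => exact fun x P Q h => hΦ x [] P Q h
  | cons y u ih =>
    exact fun x P Q h => And.imp (hΦ _ _ _ _ h)
      (Or.imp (hΨ _ _ _ _ h) (ih _ _ _ (Set.insert_subset_insert h)))

/-- Reduces the correctness of the dual unfolding to `untilRec_wordList`. -/
theorem dualUntilRec_iff_not {Φ Ψ : A × D → List (A × D) → Set D → Prop} (u : List (A × D)) :
    ∀ x P, dualUntilRec Φ Ψ x u P ↔
      ¬ untilRec (fun x u P => ¬ Φ x u P) (fun x u P => ¬ Ψ x u P) x u P := by
  induction u with
  | nil => simp [dualUntilRec, untilRec]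
  | cons y u ih =>
    intro x P
    rw [dualUntilRec, untilRec, ih]
    tauto

theorem le_iff_eq_or_succ_le {n : ℕ} {i i' : Fin n} (h : i'.val = i.val + 1) (j : Fin n) :
    i ≤ j ↔ j = i ∨ i' ≤ j := by
  simp only [Fin.le_def, Fin.ext_iff]; omega

theorem setOf_lt_succ {n : ℕ} (f : Fin n → D) {i i' : Fin n} (h : i'.val = i.val + 1) :
    insert (f i) {e | ∃ j < i, f j = e} = {e | ∃ j < i', f j = e} := by
  ext e
  simp only [Set.mem_insert_iff, Set.mem_ofPred_eq]
  constructor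
  · rintro (rfl | ⟨j, hj, rfl⟩)
    · exact ⟨i, by rw [Fin.lt_def]; omega, rfl⟩
    · exact ⟨j, by rw [Fin.lt_def] at *; omega, rfl⟩
  · rintro ⟨j, hj, rfl⟩
    by_cases hji : j = i
    · exact .inl (by rw [hji])
    · exact .inr ⟨j, by rw [Fin.lt_def, Fin.ext_iff] at *; omega, rfl⟩

/-- The list of the positions of a data word. -/
def wordList (w : DataWord A D) : List (A × D) := List.ofFn fun i => (w.letter i, w.datum i)

theorem wordList_drop (w : DataWord A D) (i : Fin (w.n + 1)) :
    (wordList w).drop i = (w.letter i, w.datum i) :: (wordList w).drop (i + 1) := by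
  rw [List.drop_eq_getElem_cons (by simp [wordList, Nat.lt_succ_iff.1 i.isLt])]
  simp only [wordList, List.getElem_ofFn]

/-- A property of positions holds at all of them if it holds at the last one and is inherited from
the next position. -/
theorem position_induction {w : DataWord A D} {motive : Fin (w.n + 1) → Prop}
    (last : ∀ i : Fin (w.n + 1), (∀ j, i ≤ j ↔ j = i) → (wordList w).drop (i + 1) = [] → motive i)
    (step : ∀ i i' : Fin (w.n + 1), i'.val = i.val + 1 → (wordList w).drop (i + 1) =
      (w.letter i', w.datum i') :: (wordList w).drop (i' + 1) → motive i' → motive i)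
    (i : Fin (w.n + 1)) : motive i := by
  induction hm : w.n - i.val generalizing i with
  | zero =>
    have hi : i.val = w.n := by omega
    exact last i (fun j => by rw [Fin.le_def, Fin.ext_iff]; omega)
      (List.drop_eq_nil_of_le (by simp [wordList, hi]))
  | succ m ih =>
    let i' : Fin (w.n + 1) := ⟨i.val + 1, by omega⟩
    exact step i i' rfl (wordList_drop w i') (ih i' (by simp only [i']; omega))

theorem mem_drop_wordList {w : DataWord A D} {e : D} (i : Fin (w.n + 1)) :
    e ∈ ((w.letter i, w.datum i) :: (wordList w).drop (i + 1)).map Prod.snd ↔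
      ∃ j, i ≤ j ∧ w.datum j = e := by
  induction i using position_induction with
  | last i h hu => simp [hu, h, eq_comm]
  | step i i' hi hu ih =>
    rw [hu, List.map_cons, List.mem_cons, ih]
    simp only [le_iff_eq_or_succ_le hi]
    constructor
    · rintro (rfl | ⟨j, hj, rfl⟩)
      exacts [⟨i, .inl rfl, rfl⟩, ⟨j, .inr hj, rfl⟩]
    · rintro ⟨j, rfl | hj, rfl⟩
      exacts [.inl rfl, .inr ⟨j, hj, rfl⟩]

theorem untilRec_wordList {w : DataWord A D} {Φ Ψ : A × D → List (A × D) → Set D → Prop}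
    (i : Fin (w.n + 1)) :
    untilRec Φ Ψ (w.letter i, w.datum i) ((wordList w).drop (i + 1)) {e | ∃ j < i, w.datum j = e} ↔
      ∃ j, i ≤ j ∧ Φ (w.letter j, w.datum j) ((wordList w).drop (j + 1))
        {e | ∃ l < j, w.datum l = e} ∧ ∀ k, i ≤ k → k < j →
          Ψ (w.letter k, w.datum k) ((wordList w).drop (k + 1)) {e | ∃ l < k, w.datum l = e} := by
  induction i using position_induction with
  | last i h hu =>
    simp only [h]
    constructor
    · exact fun hΦ => ⟨i, rfl, by rwa [hu] at hΦ ⊢, fun k hk hk' => absurd hk hk'.ne⟩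
    · rintro ⟨j, rfl, hΦ, -⟩
      rwa [hu] at hΦ ⊢
  | step i i' hi hu ih =>
    rw [hu, untilRec, setOf_lt_succ w.datum hi, ih, ← hu]
    constructor
    · rintro (hΦ | ⟨hΨ, j, hj, hΦ, hk⟩)
      · exact ⟨i, le_rfl, hΦ, fun k hk hk' => absurd hk hk'.not_ge⟩
      · refine ⟨j, (le_iff_eq_or_succ_le hi j).2 (.inr hj), hΦ, fun k hik hkj => ?_⟩
        obtain rfl | h := (le_iff_eq_or_succ_le hi k).1 hik
        exacts [hΨ, hk k h hkj]
    · rintro ⟨j, hij, hΦ, hk⟩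
      obtain rfl | h := (le_iff_eq_or_succ_le hi j).1 hij
      · exact .inl hΦ
      · have hii : i < i' := by rw [Fin.lt_def]; omega
        exact .inr ⟨hk i le_rfl (hii.trans_le h), j, h, hΦ, fun k h1 h2 => hk k (hii.le.trans h1) h2⟩

end Suffix

variable {A : Type} {D : Type*} [LinearOrder D]

/-- Satisfaction at the position `x` followed by the positions `u`, when `P` is the set of the
data at the earlier positions. -/
def Sat : OrdLTL A → A × D → List (A × D) → Set D → D → Prop
  | letter a, x, _, _, _ => x.1 = a
  | negLetter a, x, _, _, _ => ¬ x.1 = a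
  | testEq, x, _, _, d => d = x.2
  | testNe, x, _, _, d => ¬ d = x.2
  | testGt, x, _, _, d => x.2 < d
  | testLt, x, _, _, d => d < x.2
  | freeze φ, x, u, P, _ => Sat φ x u P x.2
  | next _, _, [], _, _ => False
  | next φ, x, y :: u, P, d => Sat φ y u (insert x.2 P) d
  | dualNext _, _, [], _, _ => True
  | dualNext φ, x, y :: u, P, d => Sat φ y u (insert x.2 P) d
  | untl φ ψ, x, u, P, d => untilRec (fun x u P => Sat φ x u P d) (fun x u P => Sat ψ x u P d) x u P
  | dualUntl φ ψ, x, u, P, d =>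
    dualUntilRec (fun x u P => Sat φ x u P d) (fun x u P => Sat ψ x u P d) x u P
  | existsGe φ, x, u, P, _ => ∃ e ∈ (x :: u).map Prod.snd, Sat φ x u P e
  | forallLe φ, x, u, P, _ => ∀ e ∈ insert x.2 P, Sat φ x u P e
  | conj φ ψ, x, u, P, d => Sat φ x u P d ∧ Sat ψ x u P d
  | disj φ ψ, x, u, P, d => Sat φ x u P d ∨ Sat ψ x u P d

/-- `P` matters only for `forallLe`, where it bounds a universal quantifier, and no operator negates
its arguments. The witnesses of `existsGe` come from the current and later positions, which do not
involve `P`. -/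
theorem Sat.anti (φ : OrdLTL A) : ∀ (x : A × D) (u : List (A × D)) (P Q : Set D) (d : D), P ⊆ Q →
    Sat φ x u Q d → Sat φ x u P d := by
  induction φ with
  | letter | negLetter | testEq | testNe | testGt | testLt => exact fun _ _ _ _ _ _ => id
  | freeze φ ih => exact fun x u P Q d h => ih _ _ _ _ _ h
  | next φ ih | dualNext φ ih =>
    intro x u P Q d h
    cases u with
    | nil => exact id
    | cons y u => exact ih _ _ _ _ _ (Set.insert_subset_insert h)
  | untl φ ψ ih ih' =>
    exact fun x u P Q d h => untilRec_mono (fun x u P Q h => ih x u P Q d h)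
      (fun x u P Q h => ih' x u P Q d h) u x P Q h
  | dualUntl φ ψ ih ih' =>
    exact fun x u P Q d h => dualUntilRec_mono (fun x u P Q h => ih x u P Q d h)
      (fun x u P Q h => ih' x u P Q d h) u x P Q h
  | existsGe φ ih => exact fun x u P Q d h ⟨e, he, hs⟩ => ⟨e, he, ih _ _ _ _ _ h hs⟩
  | forallLe φ ih =>
    exact fun x u P Q d h hs e he => ih _ _ _ _ _ h (hs e (Set.insert_subset_insert h he))
  | conj φ ψ ih ih' => exact fun x u P Q d h => And.imp (ih _ _ _ _ _ h) (ih' _ _ _ _ _ h)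
  | disj φ ψ ih ih' => exact fun x u P Q d h => Or.imp (ih _ _ _ _ _ h) (ih' _ _ _ _ _ h)

theorem holds_iff_sat (w : DataWord A D) (φ : OrdLTL A) : ∀ (i : Fin (w.n + 1)) (d : D),
    Holds w φ i d ↔ Sat φ (w.letter i, w.datum i) ((wordList w).drop (i + 1))
      {e | ∃ j < i, w.datum j = e} d := by
  -- The two next operators differ only at the last position, so they share one argument.
  have nextIff : ∀ φ : OrdLTL A, (∀ (i : Fin (w.n + 1)) (d : D),
      Holds w φ i d ↔ Sat φ (w.letter i, w.datum i) ((wordList w).drop (i + 1))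
        {e | ∃ j < i, w.datum j = e} d) → ∀ (i : Fin (w.n + 1)) (d : D),
      (Holds w φ.next i d ↔ Sat φ.next (w.letter i, w.datum i) ((wordList w).drop (i + 1))
        {e | ∃ j < i, w.datum j = e} d) ∧
      (Holds w φ.dualNext i d ↔ Sat φ.dualNext (w.letter i, w.datum i) ((wordList w).drop (i + 1))
        {e | ∃ j < i, w.datum j = e} d) := by
    intro φ ih i d
    by_cases hi : i.val = w.n
    · have hj : ∀ j : Fin (w.n + 1), j.val ≠ i.val + 1 := fun j => by omega
      rw [List.drop_eq_nil_of_le (by simp [wordList, hi])]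
      simp [Holds, Sat, hj]
    · let i' : Fin (w.n + 1) := ⟨i.val + 1, by omega⟩
      have hj : ∀ j : Fin (w.n + 1), j.val = i.val + 1 ↔ j = i' := fun j => by simp [Fin.ext_iff, i']
      have h : (wordList w).drop (i + 1) =
        (w.letter i', w.datum i') :: (wordList w).drop (i' + 1) := wordList_drop w i'
      rw [h]
      simp [Holds, Sat, hj, ih, setOf_lt_succ w.datum (show i'.val = i.val + 1 from rfl)]
  induction φ with
  | letter | negLetter | testEq | testNe | testGt | testLt => exact fun _ _ => Iff.rfl
  | freeze φ ih => exact fun i d => ih i _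
  | next φ ih => exact fun i d => (nextIff φ ih i d).1
  | dualNext φ ih => exact fun i d => (nextIff φ ih i d).2
  | untl φ ψ ih ih' =>
    intro i d
    rw [Sat, untilRec_wordList]
    simp only [Holds, ih, ih']
  | dualUntl φ ψ ih ih' =>
    intro i d
    rw [Sat, dualUntilRec_iff_not, untilRec_wordList]
    simp only [Holds, ih, ih']
    push Not
    refine forall_congr' fun j => forall_congr' fun _ => ?_
    tauto
  | existsGe φ ih =>
    intro i d
    simp only [Sat, mem_drop_wordList, Holds, ih]
    constructor
    · rintro ⟨j, hj, h⟩
      exact ⟨_, ⟨j, hj, rfl⟩, h⟩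
    · rintro ⟨_, ⟨j, hj, rfl⟩, h⟩
      exact ⟨j, hj, h⟩
  | forallLe φ ih =>
    intro i d
    simp only [Sat, Holds, ih]
    constructor
    · rintro h e (rfl | ⟨j, hj, rfl⟩)
      exacts [h i le_rfl, h j hj.le]
    · intro h j hj
      obtain rfl | hj := hj.eq_or_lt
      exacts [h _ (.inl rfl), h _ (.inr ⟨j, hj, rfl⟩)]
  | conj φ ψ ih ih' => exact fun i d => and_congr (ih i d) (ih' i d)
  | disj φ ψ ih ih' => exact fun i d => or_congr (ih i d) (ih' i d)

theorem satisfiable_iff_sat (φ : OrdLTL A) :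
    Satisfiable D φ ↔ ∃ (x : A × D) (u : List (A × D)), Sat φ x u ∅ x.2 := by
  have key : ∀ w : DataWord A D, Holds w φ 0 (w.datum 0) ↔
      Sat φ (w.letter 0, w.datum 0) ((wordList w).drop 1) ∅ (w.datum 0) := by
    intro w
    rw [holds_iff_sat]
    simp
  constructor
  · rintro ⟨w, hw⟩
    exact ⟨_, _, (key w).1 hw⟩
  · rintro ⟨x, u, h⟩
    refine ⟨⟨u.length, fun i => ((x :: u).get i).1, fun i => ((x :: u).get i).2⟩, (key _).2 ?_⟩
    have hl : wordList (⟨u.length, fun i => ((x :: u).get i).1, fun i => ((x :: u).get i).2⟩ :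
        DataWord A D) = x :: u := by
      simp only [wordList, Prod.mk.eta]
      exact List.ofFn_get (x :: u)
    rw [hl]
    exact h

end OrdLTL
-- Configurations and their realization by words
namespace OrdLTL

/-! Configurations are lists of labels, one for each relevant datum in increasing order. The bits of
a label are demands on its datum: bit `0` says that it occurred before, bit `1` that it occurs now
or later, and bit `f + 2` that the formula with number `f` holds when the datum is in the register. -/

section Realization

variable {k : ℕ} {D : Type*} [LinearOrder D]

/-- The demand `b` on the datum `d` is met. -/
def Meets (x : Fin k × D) (u : List (Fin k × D)) (P : Set D) (d : D) : ℕ → Prop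
  | 0 => d ∈ P
  | 1 => d ∈ (x :: u).map Prod.snd
  | f + 2 => ∀ φ : OrdLTL (Fin k), code φ = f → Sat φ x u P d

/-- The data that are demanded to have occurred before. -/
def pastData (z : List (D × ℕ)) : Set D := {d | ∃ m, (d, m) ∈ z ∧ m.testBit 0 = true}

/-- The word `x :: u` realizes the configuration `c`. -/
def Realizes (x : Fin k × D) (u : List (Fin k × D)) (c : List ℕ) : Prop :=
  ∃ z : List (D × ℕ), z.map Prod.snd = c ∧ z.Pairwise (fun e e' => e.1 < e'.1) ∧
    ∀ e ∈ z, ∀ b, e.2.testBit b = true → Meets x u (pastData z) e.1 b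

/-- Only demand `0` can be broken by a smaller past, hence the extra hypothesis. -/
theorem Meets.anti {x : Fin k × D} {u : List (Fin k × D)} {P Q : Set D} {d : D} {b : ℕ}
    (hPQ : P ⊆ Q) (h : Meets x u Q d b) (h0 : b = 0 → d ∈ P) : Meets x u P d b := by
  match b, h with
  | 0, _ => exact h0 rfl
  | 1, h => exact h
  | f + 2, h => exact fun φ hφ => Sat.anti φ _ _ _ _ _ hPQ (h φ hφ)

/-- Fewer labels demand fewer past data, which preserves the formulas; a remaining datum keeps its
own bit `0`, so it stays in the past set. This monotonicity makes Higman's lemma applicable. -/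
theorem Realizes.sublist {x : Fin k × D} {u : List (Fin k × D)} {c c' : List ℕ}
    (h : Realizes x u c) (hc : c'.Sublist c) : Realizes x u c' := by
  obtain ⟨z, rfl, hz, hm⟩ := h
  obtain ⟨z', hz', rfl⟩ := List.sublist_map_iff.1 hc
  refine ⟨z', rfl, hz.sublist hz', fun e he b hb => (hm e (hz'.subset he) b hb).anti ?_ ?_⟩
  · rintro d ⟨m, hm, h0⟩
    exact ⟨m, hz'.subset hm, h0⟩
  · rintro rfl
    exact ⟨_, he, hb⟩

end Realization

/-! ### Items and the local conditions on their labels -/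

/-- An item describes a datum at a position: its place relative to the current datum (`0` smaller,
`1` equal, `2` greater), a label it may have had before, and its labels at the current position and
at the next one. -/
abbrev Item : Type := ℕ × ℕ × ℕ × ℕ

namespace Item

/-- The place relative to the current datum. -/
def place (q : Item) : ℕ := q.1
/-- The given label. -/
def old (q : Item) : ℕ := q.2.1
/-- The label at the current position. -/
def cur (q : Item) : ℕ := q.2.2.1
/-- The label at the next position. -/
def new (q : Item) : ℕ := q.2.2.2

end Item

/-- The label `m` contains the formula with number `f`. -/
abbrev HasCode (m f : ℕ) : Prop := m.testBit (f + 2) = true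

/-- The local condition on a formula `φ` in the current label of the item `q`, where `H` is the list
of all items, `a` is the current letter, and `b` tells whether there is a next position. -/
def Local {k : ℕ} (a : ℕ) (b : Bool) (H : List Item) (q : Item) : OrdLTL (Fin k) → Prop
  | letter a' => a' = a
  | negLetter a' => a'.val ≠ a
  | testEq => q.place = 1
  | testNe => q.place ≠ 1
  | testGt => q.place = 2
  | testLt => q.place = 0
  | freeze φ => ∀ p ∈ H, p.place = 1 → HasCode p.cur φ.code
  | next φ => b = true ∧ HasCode q.new φ.code
  | dualNext φ => b = false ∨ HasCode q.new φ.code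
  | existsGe φ => ∃ p ∈ H, p.cur.testBit 1 = true ∧ HasCode p.cur φ.code
  | forallLe φ => ∀ p ∈ H, p.cur.testBit 0 = true ∨ p.place = 1 → HasCode p.cur φ.code
  | untl φ ψ => HasCode q.cur φ.code ∨
      HasCode q.cur ψ.code ∧ b = true ∧ HasCode q.new (untl φ ψ).code
  | dualUntl φ ψ => HasCode q.cur φ.code ∧
      (HasCode q.cur ψ.code ∨ b = false ∨ HasCode q.new (dualUntl φ ψ).code)
  | conj φ ψ => HasCode q.cur φ.code ∧ HasCode q.cur ψ.code
  | disj φ ψ => HasCode q.cur φ.code ∨ HasCode q.cur ψ.code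

/-- The part of `LocalCode` for compound formulas: `m` is the number of the argument, or of the pair
of the arguments, and `r` tells the operator. -/
def LocalCompound (b : Bool) (H : List Item) (q : Item) (f m r : ℕ) : Prop :=
  (r = 0 → ∀ p ∈ H, p.place = 1 → HasCode p.cur m) ∧
  (r = 1 → b = true ∧ HasCode q.new m) ∧
  (r = 2 → b = false ∨ HasCode q.new m) ∧
  (r = 3 → ∃ p ∈ H, p.cur.testBit 1 = true ∧ HasCode p.cur m) ∧
  (r = 4 → ∀ p ∈ H, p.cur.testBit 0 = true ∨ p.place = 1 → HasCode p.cur m) ∧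
  (r = 5 → HasCode q.cur m.unpair.1 ∨ HasCode q.cur m.unpair.2 ∧ b = true ∧ HasCode q.new f) ∧
  (r = 6 → HasCode q.cur m.unpair.1 ∧
    (HasCode q.cur m.unpair.2 ∨ b = false ∨ HasCode q.new f)) ∧
  (r = 7 → HasCode q.cur m.unpair.1 ∧ HasCode q.cur m.unpair.2) ∧
  (r = 8 → HasCode q.cur m.unpair.1 ∨ HasCode q.cur m.unpair.2)

/-- `Local` in terms of the number of the formula. -/
def LocalCode (k a : ℕ) (b : Bool) (H : List Item) (q : Item) (f : ℕ) : Prop :=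
  (f < k → f = a) ∧ (k ≤ f → f < 2 * k → f - k ≠ a) ∧ (f = 2 * k → q.place = 1) ∧
  (f = 2 * k + 1 → q.place ≠ 1) ∧ (f = 2 * k + 2 → q.place = 2) ∧ (f = 2 * k + 3 → q.place = 0) ∧
  (2 * k + 4 ≤ f → LocalCompound b H q f ((f - (2 * k + 4)) / 9) ((f - (2 * k + 4)) % 9))

theorem localCode_compound {k a : ℕ} {b : Bool} {H : List Item} {q : Item} {f m r : ℕ}
    (hr : r < 9) (hf : f = 2 * k + 4 + (9 * m + r)) :
    LocalCode k a b H q f ↔ LocalCompound b H q f m r := by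
  have h1 : (f - (2 * k + 4)) / 9 = m := by omega
  have h2 : (f - (2 * k + 4)) % 9 = r := by omega
  rw [LocalCode, h1, h2]
  exact ⟨fun h => h.2.2.2.2.2.2 (by omega), fun h => ⟨fun _ => by omega, fun _ _ => by omega,
    fun _ => by omega, fun _ => by omega, fun _ => by omega, fun _ => by omega, fun _ => h⟩⟩

/-- Links the condition on numbers, suited to primitive recursion, with the condition on formulas,
suited to semantic arguments. -/
theorem localCode_code {k a : ℕ} {b : Bool} {H : List Item} {q : Item} (φ : OrdLTL (Fin k)) :
    LocalCode k a b H q φ.code ↔ Local a b H q φ := by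
  cases φ with
  | letter a' =>
    have := a'.isLt
    simp only [code, LocalCode, Local]
    exact ⟨fun h => h.1 this, fun h => ⟨fun _ => h, by omega, by omega, by omega, by omega, by omega,
      by omega⟩⟩
  | negLetter a' =>
    have := a'.isLt
    simp only [code, LocalCode, Local, Nat.add_sub_cancel_left]
    exact ⟨fun h => h.2.1 (by omega) (by omega), fun h => ⟨by omega, fun _ _ => h, by omega,
      by omega, by omega, by omega, by omega⟩⟩
  | testEq =>
    simp only [code, LocalCode, Local]
    exact ⟨fun h => h.2.2.1 trivial, fun h => ⟨by omega, by omega, fun _ => h, by omega, by omega,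
      by omega, by omega⟩⟩
  | testNe =>
    simp only [code, LocalCode, Local]
    exact ⟨fun h => h.2.2.2.1 trivial, fun h => ⟨by omega, by omega, by omega, fun _ => h, by omega,
      by omega, by omega⟩⟩
  | testGt =>
    simp only [code, LocalCode, Local]
    exact ⟨fun h => h.2.2.2.2.1 trivial, fun h => ⟨by omega, by omega, by omega, by omega, fun _ => h,
      by omega, by omega⟩⟩
  | testLt =>
    simp only [code, LocalCode, Local]
    exact ⟨fun h => h.2.2.2.2.2.1 trivial, fun h => ⟨by omega, by omega, by omega, by omega, by omega,
      fun _ => h, by omega⟩⟩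
  | freeze φ =>
    refine (localCode_compound (m := φ.code) (r := 0) (by omega) (by simp only [code]; try omega)).trans ?_
    simp [LocalCompound, Local]
  | next φ =>
    refine (localCode_compound (m := φ.code) (r := 1) (by omega) (by simp only [code]; try omega)).trans ?_
    simp [LocalCompound, Local]
  | dualNext φ =>
    refine (localCode_compound (m := φ.code) (r := 2) (by omega) (by simp only [code]; try omega)).trans ?_
    simp [LocalCompound, Local]
  | existsGe φ =>
    refine (localCode_compound (m := φ.code) (r := 3) (by omega) (by simp only [code]; try omega)).trans ?_
    simp [LocalCompound, Local]
  | forallLe φ =>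
    refine (localCode_compound (m := φ.code) (r := 4) (by omega) (by simp only [code]; try omega)).trans ?_
    simp [LocalCompound, Local]
  | untl φ ψ =>
    refine (localCode_compound (m := Nat.pair φ.code ψ.code) (r := 5) (by omega) (by simp only [code]; try omega)).trans ?_
    simp [LocalCompound, Local]
  | dualUntl φ ψ =>
    refine (localCode_compound (m := Nat.pair φ.code ψ.code) (r := 6) (by omega) (by simp only [code]; try omega)).trans ?_
    simp [LocalCompound, Local]
  | conj φ ψ =>
    refine (localCode_compound (m := Nat.pair φ.code ψ.code) (r := 7) (by omega) (by simp only [code]; try omega)).trans ?_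
    simp [LocalCompound, Local]
  | disj φ ψ =>
    refine (localCode_compound (m := Nat.pair φ.code ψ.code) (r := 8) (by omega) (by simp only [code]; try omega)).trans ?_
    simp [LocalCompound, Local]

/-- All sublists of a list. -/
def allSublists (l : List ℕ) : List (List ℕ) :=
  l.foldr (fun x L => L ++ L.map (x :: ·)) [[]]

theorem mem_allSublists {l s : List ℕ} : s ∈ allSublists l ↔ s.Sublist l := by
  induction l generalizing s with
  | nil => simp [allSublists]
  | cons x l ih =>
    rw [allSublists, List.foldr_cons, ← allSublists, List.sublist_cons_iff]
    simp only [List.mem_append, List.mem_map, ih]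
    exact or_congr_right ⟨fun ⟨r, h, e⟩ => ⟨r, e.symm, h⟩, fun ⟨r, e, h⟩ => ⟨r, h, e.symm⟩⟩

/-- The list `H` of items is consistent and starts from the configuration `s`. The labels are
smaller than `2 ^ K`. -/
def Valid (k K a : ℕ) (b : Bool) (s : List ℕ) (H : List Item) : Prop :=
  s ∈ allSublists (H.map Item.old) ∧
  ∀ q ∈ H, (∀ i < K, q.old.testBit i = true → q.cur.testBit i = true) ∧
    (q.cur.testBit 1 = true → q.place = 1 ∨ b = true ∧ q.new.testBit 1 = true) ∧
    (b = true → q.cur.testBit 0 = true ∨ q.place = 1 → q.new.testBit 0 = true) ∧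
    ∀ f < K, HasCode q.cur f → LocalCode k a b H q f

/-- All items with the given place whose labels are smaller than `2 ^ K`. -/
def itemList (t K : ℕ) : List Item :=
  (List.range (2 ^ K)).flatMap fun o => (List.range (2 ^ K)).flatMap fun c =>
    (List.range (2 ^ K)).map fun n => (t, o, c, n)

theorem mem_itemList {t K : ℕ} {q : Item} :
    q ∈ itemList t K ↔ q.place = t ∧ q.old < 2 ^ K ∧ q.cur < 2 ^ K ∧ q.new < 2 ^ K := by
  obtain ⟨t', o, c, n⟩ := q
  simp only [itemList, List.mem_flatMap, List.mem_map, List.mem_range, Item.place, Item.old,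
    Item.cur, Item.new, Prod.mk.injEq]
  constructor
  · rintro ⟨o, ho, c, hc, n, hn, rfl, rfl, rfl, rfl⟩
    exact ⟨rfl, ho, hc, hn⟩
  · rintro ⟨rfl, ho, hc, hn⟩
    exact ⟨o, ho, c, hc, n, hn, rfl, rfl, rfl, rfl⟩

/-- All lists over `L` of length at most `n`. -/
def listsUpTo {α : Type*} (L : List α) : ℕ → List (List α)
  | 0 => [[]]
  | n + 1 => [] :: L.flatMap fun x => (listsUpTo L n).map fun l => x :: l

theorem mem_listsUpTo {α : Type*} {L : List α} {n : ℕ} {l : List α} :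
    l ∈ listsUpTo L n ↔ l.length ≤ n ∧ ∀ x ∈ l, x ∈ L := by
  induction n generalizing l with
  | zero => simp +contextual [listsUpTo]
  | succ n ih =>
    cases l with
    | nil => simp [listsUpTo]
    | cons y l => simp [listsUpTo, ih]; tauto

/-- The candidates for the list of items at a position. -/
def candidates (K n : ℕ) : List (List Item) :=
  (listsUpTo (itemList 0 K) n).flatMap fun l => (itemList 1 K).flatMap fun c =>
    (listsUpTo (itemList 2 K) n).map fun r => l ++ c :: r

theorem mem_candidates {K n : ℕ} {H : List Item} :
    H ∈ candidates K n ↔ ∃ l c r, H = l ++ c :: r ∧ l.length ≤ n ∧ r.length ≤ n ∧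
      (∀ q ∈ l, q ∈ itemList 0 K) ∧ c ∈ itemList 1 K ∧ ∀ q ∈ r, q ∈ itemList 2 K := by
  simp only [candidates, List.mem_flatMap, List.mem_map, mem_listsUpTo]
  constructor
  · rintro ⟨l, ⟨hl, hl'⟩, c, hc, r, ⟨hr, hr'⟩, rfl⟩
    exact ⟨l, c, r, rfl, hl, hr, hl', hc, hr'⟩
  · rintro ⟨l, c, r, rfl, hl, hr, hl', hc, hr'⟩
    exact ⟨l, ⟨hl, hl'⟩, c, hc, r, ⟨hr, hr'⟩, rfl⟩

end OrdLTL
namespace OrdLTL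

/-! ### Soundness: consistent items carry realizability backwards -/

section Sound

variable {k : ℕ} {D : Type*} [LinearOrder D]

theorem lt_of_testBit {m K i : ℕ} (hm : m < 2 ^ K) (hi : m.testBit i = true) : i < K :=
  (Nat.pow_lt_pow_iff_right (by norm_num)).1 ((Nat.ge_two_pow_of_testBit hi).trans_lt hm)

/-- The data demanded by the current labels of valued items to have occurred before. -/
def curPast (h : List (D × Item)) : Set D := {d | ∃ q, (d, q) ∈ h ∧ q.cur.testBit 0 = true}

/-- The data demanded by the next labels of valued items to have occurred before. -/
def newPast (h : List (D × Item)) : Set D := {d | ∃ q, (d, q) ∈ h ∧ q.new.testBit 0 = true}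

/-- The valued items `h` describe the position `x` as far as the order of the data is concerned. -/
structure Placed (x : Fin k × D) (h : List (D × Item)) : Prop where
  current : ∃ q, (x.2, q) ∈ h
  eq : ∀ e ∈ h, e.2.place = 1 ↔ e.1 = x.2
  gt : ∀ e ∈ h, e.2.place = 2 → x.2 < e.1
  lt : ∀ e ∈ h, e.2.place = 0 → e.1 < x.2

/-- The next labels of the valued items `h` are realized by `u`. -/
def RealizesNew (b : Bool) (u : List (Fin k × D)) (h : List (D × Item)) : Prop :=
  b = false ∧ u = [] ∨ b = true ∧ ∃ y u', u = y :: u' ∧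
    ∀ e ∈ h, ∀ i, e.2.new.testBit i = true → Meets y u' (newPast h) e.1 i

/-- The next labels are assumed to be met semantically, so an `untl` or `dualUntl` demand postponed
to the next position is already true there. Induction on the formula therefore suffices, with none
along the word. -/
theorem sat_of_valid {K : ℕ} {b : Bool} {s : List ℕ} {x : Fin k × D} {u : List (Fin k × D)}
    {h : List (D × Item)} (hp : Placed x h) (hu : RealizesNew b u h)
    (hK : ∀ e ∈ h, e.2.cur < 2 ^ K) (hv : Valid k K x.1 b s (h.map Prod.snd))
    (φ : OrdLTL (Fin k)) : ∀ e ∈ h, HasCode e.2.cur φ.code → Sat φ x u (curPast h) e.1 := by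
  have hloc : ∀ φ : OrdLTL (Fin k), ∀ e ∈ h, HasCode e.2.cur φ.code →
      Local x.1 b (h.map Prod.snd) e.2 φ := fun φ e he hc =>
    (localCode_code φ).1 ((hv.2 e.2 (List.mem_map_of_mem he)).2.2.2 _
      (by have := lt_of_testBit (hK e he) hc; omega) hc)
  -- The next labels are met with the past `newPast h`; this inclusion and `Sat.anti` transfer them
  -- to the past that `Sat` prescribes at the next position.
  have hpast : b = true → insert x.2 (curPast h) ⊆ newPast h := by
    rintro hb d (rfl | ⟨q, hq, h0⟩)
    · obtain ⟨q, hq⟩ := hp.current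
      exact ⟨q, hq, (hv.2 q (List.mem_map_of_mem hq)).2.2.1 hb (.inr ((hp.eq _ hq).2 rfl))⟩
    · exact ⟨q, hq, (hv.2 q (List.mem_map_of_mem hq)).2.2.1 hb (.inl h0)⟩
  have hnew : ∀ φ : OrdLTL (Fin k), ∀ e ∈ h, b = true → HasCode e.2.new φ.code →
      ∃ y u', u = y :: u' ∧ Sat φ y u' (insert x.2 (curPast h)) e.1 := by
    intro φ e he hb hc
    obtain ⟨hb', -⟩ | ⟨-, y, u', rfl, hm⟩ := hu
    · simp [hb'] at hb
    · exact ⟨y, u', rfl, Sat.anti φ _ _ _ _ _ (hpast hb) (hm e he _ hc φ rfl)⟩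
  have hend : b = false → u = [] := by
    intro hb
    obtain ⟨-, h⟩ | ⟨hb', -⟩ := hu
    exacts [h, by simp [hb'] at hb]
  induction φ with
  | letter a => exact fun e he hc => Fin.ext (hloc _ e he hc).symm
  | negLetter a => exact fun e he hc ha => hloc _ e he hc (congrArg Fin.val ha.symm)
  | testEq => exact fun e he hc => (hp.eq e he).1 (hloc _ e he hc)
  | testNe => exact fun e he hc h1 => hloc _ e he hc ((hp.eq e he).2 h1)
  | testGt => exact fun e he hc => hp.gt e he (hloc _ e he hc)
  | testLt => exact fun e he hc => hp.lt e he (hloc _ e he hc)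
  | freeze φ ih =>
    intro e he hc
    obtain ⟨q, hq⟩ := hp.current
    exact ih _ hq (hloc _ e he hc q (List.mem_map_of_mem hq) ((hp.eq _ hq).2 rfl))
  | next φ ih =>
    intro e he hc
    obtain ⟨hb, hn⟩ := hloc _ e he hc
    obtain ⟨y, u', rfl, hs⟩ := hnew φ e he hb hn
    exact hs
  | dualNext φ ih =>
    intro e he hc
    cases hb : b with
    | false => rw [hend hb]; trivial
    | true =>
      obtain ⟨y, u', rfl, hs⟩ := hnew φ e he hb ((hloc _ e he hc).resolve_left (by simp [hb]))
      exact hs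
  | existsGe φ ih =>
    intro e he hc
    obtain ⟨q, hq, h1, hc'⟩ := hloc _ e he hc
    obtain ⟨⟨d, q⟩, hdq, rfl⟩ := List.mem_map.1 hq
    refine ⟨d, ?_, ih _ hdq hc'⟩
    obtain ht | ⟨hb, hn⟩ := (hv.2 q hq).2.1 h1
    · rw [show d = x.2 from (hp.eq _ hdq).1 ht]
      exact List.mem_cons_self
    · obtain ⟨hb', -⟩ | ⟨-, y, u', rfl, hm⟩ := hu
      · simp [hb'] at hb
      · exact List.mem_cons_of_mem _ (hm _ hdq 1 hn)
  | forallLe φ ih =>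
    rintro e he hc d (rfl | ⟨q, hq, h0⟩)
    · obtain ⟨q, hq⟩ := hp.current
      exact ih _ hq (hloc _ e he hc q (List.mem_map_of_mem hq) (.inr ((hp.eq _ hq).2 rfl)))
    · exact ih _ hq (hloc _ e he hc q (List.mem_map_of_mem hq) (.inl h0))
  | untl φ ψ ih ih' =>
    intro e he hc
    obtain hφ | ⟨hψ, hb, hn⟩ := hloc _ e he hc
    · have := ih e he hφ
      cases u with
      | nil => exact this
      | cons y u => exact .inl this
    · obtain ⟨y, u', rfl, hs⟩ := hnew _ e he hb hn
      exact .inr ⟨ih' e he hψ, hs⟩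
  | dualUntl φ ψ ih ih' =>
    intro e he hc
    obtain ⟨hφ, h'⟩ := hloc _ e he hc
    have hφ' := ih e he hφ
    cases hb : b with
    | false => rw [hend hb] at hφ' ⊢; exact hφ'
    | true =>
      obtain hψ | hb' | hn := h'
      · have := ih' e he hψ
        cases u with
        | nil => exact hφ'
        | cons y u => exact ⟨hφ', .inl this⟩
      · simp [hb] at hb'
      · obtain ⟨y, u', rfl, hs⟩ := hnew _ e he hb hn
        exact ⟨hφ', .inr hs⟩
  | conj φ ψ ih ih' =>
    exact fun e he hc => (hloc _ e he hc).imp (ih e he) (ih' e he)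
  | disj φ ψ ih ih' =>
    exact fun e he hc => (hloc _ e he hc).imp (ih e he) (ih' e he)

/-- The current labels are met with the past `curPast h`. The old labels are contained in them, so
they ask for less and have a smaller past set. -/
theorem realizes_of_valid {K : ℕ} {b : Bool} {s : List ℕ} {x : Fin k × D} {u : List (Fin k × D)}
    {h : List (D × Item)} (hsort : h.Pairwise fun e e' => e.1 < e'.1) (hp : Placed x h)
    (hu : RealizesNew b u h) (hK : ∀ e ∈ h, e.2.old < 2 ^ K ∧ e.2.cur < 2 ^ K)
    (hv : Valid k K x.1 b s (h.map Prod.snd)) : Realizes x u s := by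
  -- The items may also describe data that `s` does not mention, so `s` is only a sublist of the old
  -- labels.
  refine Realizes.sublist (c := (h.map Prod.snd).map Item.old) ?_ (mem_allSublists.1 hv.1)
  refine ⟨h.map fun e => (e.1, e.2.old), by simp, by simpa [List.pairwise_map] using hsort, ?_⟩
  intro e he i hi
  obtain ⟨e, he', rfl⟩ := List.mem_map.1 he
  replace hi : e.2.old.testBit i = true := hi
  clear he
  rename' he' => he
  have hcur : ∀ e ∈ h, ∀ i, e.2.old.testBit i = true → e.2.cur.testBit i = true := fun e he i hi =>
    (hv.2 e.2 (List.mem_map_of_mem he)).1 i (lt_of_testBit (hK e he).1 hi) hi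
  have hm : Meets x u (curPast h) e.1 i := by
    have hc := hcur e he i hi
    match i, hc with
    | 0, hc => exact ⟨e.2, he, hc⟩
    | 1, hc =>
      obtain ht | ⟨hb, hn⟩ := (hv.2 _ (List.mem_map_of_mem he)).2.1 hc
      · rw [(hp.eq _ he).1 ht]
        exact List.mem_cons_self
      · obtain ⟨hb', -⟩ | ⟨-, y, u', rfl, hm⟩ := hu
        · simp [hb'] at hb
        · exact List.mem_cons_of_mem _ (hm _ he 1 hn)
    | f + 2, hc =>
      rintro φ rfl
      exact sat_of_valid hp hu (fun e he => (hK e he).2) hv φ e he hc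
  refine hm.anti ?_ ?_
  · rintro d ⟨m, hm, h0⟩
    obtain ⟨e, he, heq⟩ := List.mem_map.1 hm
    cases heq
    exact ⟨e.2, he, hcur e he 0 h0⟩
  · rintro rfl
    exact ⟨_, List.mem_map_of_mem he, hi⟩

/-- Increasing values for candidate items place them at a position with any given letter. -/
theorem exists_placed {K n : ℕ} {h : List (D × Item)} (hc : h.map Prod.snd ∈ candidates K n)
    (hsort : h.Pairwise fun e e' => e.1 < e'.1) (a : Fin k) : ∃ d, Placed (a, d) h := by
  obtain ⟨l, c, r, heq, -, -, hl, hc, hr⟩ := mem_candidates.1 hc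
  obtain ⟨l', r₁, rfl, rfl, hr₁⟩ := List.map_eq_append_iff.1 heq
  obtain ⟨⟨d, c'⟩, r', rfl, rfl, rfl⟩ := List.map_eq_cons_iff.1 hr₁
  have hl0 : ∀ e ∈ l', e.2.place = 0 := fun e he =>
    (mem_itemList.1 (hl _ (List.mem_map_of_mem he))).1
  have hr0 : ∀ e ∈ r', e.2.place = 2 := fun e he =>
    (mem_itemList.1 (hr _ (List.mem_map_of_mem he))).1
  have hc0 : c'.place = 1 := (mem_itemList.1 hc).1
  rw [List.pairwise_append, List.pairwise_cons] at hsort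
  obtain ⟨-, ⟨hdr, -⟩, hld⟩ := hsort
  have hlt : ∀ e ∈ l', e.1 < d := fun e he => hld e he _ List.mem_cons_self
  refine ⟨d, ⟨c', by simp⟩, ?_, ?_, ?_⟩ <;> intro e he <;>
    rw [List.mem_append, List.mem_cons] at he <;> obtain he | rfl | he := he
  · simp [hl0 e he, (hlt e he).ne]
  · simp [hc0]
  · simp [hr0 e he, (hdr e he).ne']
  · simp [hl0 e he]
  · simp [hc0]
  · exact fun _ => hdr e he
  · exact fun _ => hlt e he
  · simp [hc0]
  · simp [hr0 e he]

theorem lt_of_mem_candidates {K n : ℕ} {H : List Item} (hH : H ∈ candidates K n) {q : Item}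
    (hq : q ∈ H) : q.old < 2 ^ K ∧ q.cur < 2 ^ K ∧ q.new < 2 ^ K := by
  obtain ⟨l, c, r, rfl, -, -, hl, hc, hr⟩ := mem_candidates.1 hH
  rw [List.mem_append, List.mem_cons] at hq
  obtain hq | rfl | hq := hq
  exacts [(mem_itemList.1 (hl _ hq)).2, (mem_itemList.1 hc).2, (mem_itemList.1 (hr _ hq)).2]

theorem exists_map_of_map_eq {α β γ : Type*} {f : β → γ} {z : List (α × γ)} {H : List β}
    (hz : z.map Prod.snd = H.map f) :
    ∃ h : List (α × β), h.map Prod.snd = H ∧ h.map (fun e => (e.1, f e.2)) = z := by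
  induction z generalizing H with
  | nil => exact ⟨[], by simp_all⟩
  | cons e z ih =>
    obtain ⟨q, H', rfl, hq, hH⟩ := List.map_eq_cons_iff.1 hz.symm
    obtain ⟨h, rfl, rfl⟩ := ih hH.symm
    exact ⟨(e.1, q) :: h, rfl, by simp [hq]⟩

/-- The values realizing the next labels are reused for the items, and the current datum is the
value of the item with place `1`. No new value has to be fitted between old ones. -/
theorem realizes_of_valid_true {K n : ℕ} {s : List ℕ} {H : List Item} {a : Fin k}
    {y : Fin k × D} {u : List (Fin k × D)} (hH : H ∈ candidates K n) (hv : Valid k K a true s H)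
    (hr : Realizes y u (H.map Item.new)) : ∃ d : D, Realizes (a, d) (y :: u) s := by
  obtain ⟨z, hz, hsort, hm⟩ := hr
  obtain ⟨h, hh1, hh2⟩ := exists_map_of_map_eq hz
  subst hh1 hh2
  rw [List.pairwise_map] at hsort
  obtain ⟨d, hp⟩ := exists_placed hH hsort a
  refine ⟨d, realizes_of_valid hsort hp (.inr ⟨rfl, y, u, rfl, fun e he i hi => ?_⟩) (fun e he => ?_) hv⟩
  · have := hm _ (List.mem_map_of_mem he) i hi
    have hpe : pastData (h.map fun e => (e.1, e.2.new)) = newPast h := by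
      ext d
      simp [pastData, newPast]
    rwa [hpe] at this
  · have := lt_of_mem_candidates hH (List.mem_map_of_mem he)
    exact ⟨this.1, this.2.1⟩

theorem exists_sorted_list [Infinite D] (n : ℕ) : ∃ v : List D, v.length = n ∧ v.Pairwise (· < ·) := by
  obtain ⟨s, hs⟩ := Infinite.exists_subset_card_eq D n
  exact ⟨s.sort, by simp [hs], s.sortedLT_sort.pairwise⟩

/-- With no next position to constrain the values, any increasing chain of the right length works;
this is where `D` has to be infinite. -/
theorem realizes_of_valid_false [Infinite D] {K n : ℕ} {s : List ℕ} {H : List Item} {a : Fin k}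
    (hH : H ∈ candidates K n) (hv : Valid k K a false s H) : ∃ d : D, Realizes (a, d) [] s := by
  obtain ⟨v, hlen, hsort⟩ := exists_sorted_list (D := D) H.length
  obtain ⟨h, rfl, rfl⟩ : ∃ h : List (D × Item), h.map Prod.snd = H ∧ h.map Prod.fst = v :=
    ⟨v.zip H, List.map_snd_zip hlen.ge, List.map_fst_zip hlen.le⟩
  rw [List.pairwise_map] at hsort
  obtain ⟨d, hp⟩ := exists_placed hH hsort a
  refine ⟨d, realizes_of_valid hsort hp (.inl ⟨rfl, rfl⟩) (fun e he => ?_) hv⟩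
  have := lt_of_mem_candidates hH (List.mem_map_of_mem he)
  exact ⟨this.1, this.2.1⟩

end Sound

end OrdLTL
namespace OrdLTL

theorem exists_mask (p : ℕ → Prop) (K : ℕ) :
    ∃ m < 2 ^ K, ∀ i, m.testBit i = true ↔ i < K ∧ p i := by
  classical
  refine ⟨Nat.ofBits fun i : Fin K => decide (p i), Nat.ofBits_lt_two_pow _, fun i => ?_⟩
  by_cases hi : i < K
  · simp [Nat.testBit_ofBits_lt _ _ hi, hi]
  · simp [Nat.testBit_ofBits_ge _ _ (not_lt.1 hi), hi]

/-! ### Completeness: realizing words yield bounded consistent items -/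

section Complete

variable {k : ℕ} {D : Type*} [LinearOrder D]

/-- The labels `cur` and `new` tell which demands are met at the position `x` and at the next
one. -/
structure Exact (K : ℕ) (x : Fin k × D) (u : List (Fin k × D)) (P : Set D) (cur new : D → ℕ) :
    Prop where
  cur_lt : ∀ d, cur d < 2 ^ K
  new_lt : ∀ d, new d < 2 ^ K
  testBit_cur : ∀ d i, (cur d).testBit i = true ↔ i < K ∧ Meets x u P d i
  testBit_new : ∀ y u', u = y :: u' → ∀ d i, (new d).testBit i = true ↔
    i < K ∧ Meets y u' (insert x.2 P) d i

theorem exists_exact (K : ℕ) (x : Fin k × D) (u : List (Fin k × D)) (P : Set D) :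
    ∃ cur new, Exact K x u P cur new := by
  choose cur hcur hcur' using fun d => exists_mask (Meets x u P d) K
  choose new hnew hnew' using fun (y : Fin k × D) u' d =>
    exists_mask (Meets y u' (insert x.2 P) d) K
  cases u with
  -- There is no next position, so the next labels are arbitrary; `0` respects the bound.
  | nil => exact ⟨cur, fun _ => 0, hcur, fun _ => by positivity, hcur', by simp⟩
  | cons y u =>
    refine ⟨cur, new y u, hcur, hnew y u, hcur', ?_⟩
    rintro _ _ ⟨rfl, rfl⟩
    exact hnew' y u

theorem Exact.hasCode_cur {K : ℕ} {x : Fin k × D} {u : List (Fin k × D)} {P : Set D}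
    {cur new : D → ℕ} (h : Exact K x u P cur new) (φ : OrdLTL (Fin k)) (d : D) :
    HasCode (cur d) φ.code ↔ φ.code + 2 < K ∧ Sat φ x u P d := by
  rw [HasCode, h.testBit_cur, Meets]
  exact and_congr_right fun _ => ⟨fun h => h φ rfl, fun h ψ hψ => code_injective hψ ▸ h⟩

theorem Exact.hasCode_new {K : ℕ} {x y : Fin k × D} {u : List (Fin k × D)} {P : Set D}
    {cur new : D → ℕ} (h : Exact K x (y :: u) P cur new) (φ : OrdLTL (Fin k)) (d : D) :
    HasCode (new d) φ.code ↔ φ.code + 2 < K ∧ Sat φ y u (insert x.2 P) d := by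
  rw [HasCode, h.testBit_new y u rfl, Meets]
  exact and_congr_right fun _ => ⟨fun h => h φ rfl, fun h ψ hψ => code_injective hψ ▸ h⟩

/-- The place of `d` relative to the current datum `d₀`. -/
def placeOf (d₀ d : D) : ℕ := if d < d₀ then 0 else if d = d₀ then 1 else 2

theorem placeOf_eq_zero {d₀ d : D} : placeOf d₀ d = 0 ↔ d < d₀ := by
  unfold placeOf; grind

theorem placeOf_eq_one {d₀ d : D} : placeOf d₀ d = 1 ↔ d = d₀ := by
  unfold placeOf; grind

theorem placeOf_eq_two {d₀ d : D} : placeOf d₀ d = 2 ↔ d₀ < d := by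
  unfold placeOf; grind

/-- Every formula that holds for some datum of the word holds for one of boundedly many data. -/
theorem exists_witness (x : Fin k × D) (u : List (Fin k × D)) (P : Set D) :
    ∃ W : ℕ → D, ∀ φ : OrdLTL (Fin k), ∀ e ∈ (x :: u).map Prod.snd, Sat φ x u P e →
      W φ.code ∈ (x :: u).map Prod.snd ∧ Sat φ x u P (W φ.code) := by
  have (f : ℕ) : ∃ d : D, ∀ φ : OrdLTL (Fin k), φ.code = f → ∀ e ∈ (x :: u).map Prod.snd,
      Sat φ x u P e → d ∈ (x :: u).map Prod.snd ∧ Sat φ x u P d := by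
    obtain ⟨φ, rfl⟩ := code_surjective (k := k) f
    by_cases h : ∃ e ∈ (x :: u).map Prod.snd, Sat φ x u P e
    · obtain ⟨e, he⟩ := h
      exact ⟨e, fun ψ hψ _ _ _ => code_injective hψ ▸ he⟩
    · exact ⟨x.2, fun ψ hψ e he hs => (h ⟨e, he, code_injective hψ ▸ hs⟩).elim⟩
  choose W hW using this
  exact ⟨W, fun φ => hW φ.code φ rfl⟩

/-- A true formula unfolds into true formulas that are its arguments, with smaller numbers, or
itself at the next position, so their bits stay below `K`. Only `existsGe` requires an item to
exist, and `hV` provides it. -/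
theorem local_of_exact {K : ℕ} {x : Fin k × D} {u : List (Fin k × D)} {P : Set D}
    {cur new old : D → ℕ} (h : Exact K x u P cur new) {V : List D} {H : List Item}
    (hH : H = V.map fun d => (placeOf x.2 d, old d, cur d, new d))
    (hV : ∀ φ : OrdLTL (Fin k), φ.code < K → ∀ e ∈ (x :: u).map Prod.snd, Sat φ x u P e →
      ∃ e ∈ V, e ∈ (x :: u).map Prod.snd ∧ Sat φ x u P e)
    (φ : OrdLTL (Fin k)) (d : D) (hK : φ.code + 2 < K) (hs : Sat φ x u P d) :
    Local x.1 (!u.isEmpty) H (placeOf x.2 d, old d, cur d, new d) φ := by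
  cases φ with
  | letter a => exact congrArg Fin.val (Eq.symm hs)
  | negLetter a => exact fun ha => hs (Fin.ext ha.symm)
  | testEq => exact placeOf_eq_one.2 hs
  | testNe => exact fun h1 => hs (placeOf_eq_one.1 h1)
  | testGt => exact placeOf_eq_two.2 hs
  | testLt => exact placeOf_eq_zero.2 hs
  | freeze φ =>
    intro p hp h1
    rw [hH] at hp
    obtain ⟨e, he, rfl⟩ := List.mem_map.1 hp
    obtain rfl := placeOf_eq_one.1 h1
    rw [code] at hK
    exact (h.hasCode_cur φ _).2 ⟨by omega, hs⟩
  | next φ =>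
    rw [code] at hK
    cases u with
    | nil => exact hs.elim
    | cons y u => exact ⟨rfl, (h.hasCode_new φ d).2 ⟨by omega, hs⟩⟩
  | dualNext φ =>
    rw [code] at hK
    cases u with
    | nil => exact .inl rfl
    | cons y u => exact .inr ((h.hasCode_new φ d).2 ⟨by omega, hs⟩)
  | existsGe φ =>
    rw [code] at hK
    obtain ⟨e, he, hs⟩ := hs
    obtain ⟨e, heV, he, hs⟩ := hV φ (by omega) e he hs
    exact ⟨(placeOf x.2 e, old e, cur e, new e), hH ▸ List.mem_map_of_mem heV, (h.testBit_cur e 1).2 ⟨by omega, he⟩,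
      (h.hasCode_cur φ e).2 ⟨by omega, hs⟩⟩
  | forallLe φ =>
    rw [code] at hK
    intro p hp h1
    rw [hH] at hp
    obtain ⟨e, he, rfl⟩ := List.mem_map.1 hp
    refine (h.hasCode_cur φ _).2 ⟨by omega, hs e ?_⟩
    exact h1.elim (fun h0 => .inr ((h.testBit_cur e 0).1 h0).2) fun h1 => .inl (placeOf_eq_one.1 h1)
  | untl φ ψ =>
    have hK' := hK
    have h1 := Nat.left_le_pair φ.code ψ.code
    have h2 := Nat.right_le_pair φ.code ψ.code
    rw [code] at hK
    have hφ : Sat φ x u P d → HasCode (cur d) φ.code := fun hs =>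
      (h.hasCode_cur φ d).2 ⟨by omega, hs⟩
    cases u with
    | nil => exact .inl (hφ hs)
    | cons y u =>
      exact hs.imp hφ fun hs => ⟨(h.hasCode_cur ψ d).2 ⟨by omega, hs.1⟩, rfl,
        (h.hasCode_new _ d).2 ⟨hK', hs.2⟩⟩
  | dualUntl φ ψ =>
    have hK' := hK
    have h1 := Nat.left_le_pair φ.code ψ.code
    have h2 := Nat.right_le_pair φ.code ψ.code
    rw [code] at hK
    have hφ : Sat φ x u P d → HasCode (cur d) φ.code := fun hs =>
      (h.hasCode_cur φ d).2 ⟨by omega, hs⟩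
    cases u with
    | nil => exact ⟨hφ hs, .inr (.inl rfl)⟩
    | cons y u =>
      exact hs.imp hφ fun hs => hs.imp (fun hs => (h.hasCode_cur ψ d).2 ⟨by omega, hs⟩)
        fun hs => .inr ((h.hasCode_new _ d).2 ⟨hK', hs⟩)
  | conj φ ψ =>
    have h1 := Nat.left_le_pair φ.code ψ.code
    have h2 := Nat.right_le_pair φ.code ψ.code
    rw [code] at hK
    exact hs.imp (fun hs => (h.hasCode_cur φ d).2 ⟨by omega, hs⟩)
      fun hs => (h.hasCode_cur ψ d).2 ⟨by omega, hs⟩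
  | disj φ ψ =>
    have h1 := Nat.left_le_pair φ.code ψ.code
    have h2 := Nat.right_le_pair φ.code ψ.code
    rw [code] at hK
    exact hs.imp (fun hs => (h.hasCode_cur φ d).2 ⟨by omega, hs⟩)
      fun hs => (h.hasCode_cur ψ d).2 ⟨by omega, hs⟩

theorem mem_candidates_of_sorted {K n : ℕ} {d₀ : D} {V : List D} {cur new old : D → ℕ}
    (hV : V.Pairwise (· < ·)) (hd : d₀ ∈ V) (hn : V.length ≤ n) (ho : ∀ d, old d < 2 ^ K)
    (hc : ∀ d, cur d < 2 ^ K) (hw : ∀ d, new d < 2 ^ K) :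
    (V.map fun d => (placeOf d₀ d, old d, cur d, new d)) ∈ candidates K n := by
  obtain ⟨l, r, rfl⟩ := List.append_of_mem hd
  rw [List.pairwise_append, List.pairwise_cons] at hV
  obtain ⟨-, ⟨hr, -⟩, hl⟩ := hV
  rw [List.length_append, List.length_cons] at hn
  refine mem_candidates.2 ⟨_, (placeOf d₀ d₀, old d₀, cur d₀, new d₀), _, by rw [List.map_append, List.map_cons], by simp; omega,
    by simp; omega, ?_, mem_itemList.2 ⟨placeOf_eq_one.2 rfl, ho _, hc _, hw _⟩, ?_⟩
  · simp only [List.forall_mem_map]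
    exact fun d h => mem_itemList.2 ⟨placeOf_eq_zero.2 (hl d h _ List.mem_cons_self), ho _, hc _,
      hw _⟩
  · simp only [List.forall_mem_map]
    exact fun d h => mem_itemList.2 ⟨placeOf_eq_two.2 (hr d h), ho _, hc _, hw _⟩

/-- The data in `z` are distinct, so its labels form a function; all other data get `0`, which
demands nothing. -/
theorem exists_old {z : List (D × ℕ)} (hz : z.Pairwise fun e e' => e.1 < e'.1) :
    ∃ old : D → ℕ, (∀ e ∈ z, old e.1 = e.2) ∧ ∀ d, old d = 0 ∨ (d, old d) ∈ z := by
  classical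
  have hinj : ∀ e ∈ z, ∀ e' ∈ z, e.1 = e'.1 → e = e' := by
    have hnd : (z.map Prod.fst).Nodup := List.pairwise_map.2 (hz.imp fun h => h.ne)
    exact fun e he e' he' h => List.inj_on_of_nodup_map hnd he he' h
  have (d : D) : ∃ m, (∀ e ∈ z, e.1 = d → m = e.2) ∧ (m = 0 ∨ (d, m) ∈ z) := by
    by_cases h : ∃ m, (d, m) ∈ z
    · obtain ⟨m, hm⟩ := h
      exact ⟨m, fun e he hd => by rw [← hinj _ hm _ he hd.symm], .inr hm⟩
    · exact ⟨0, fun e he hd => (h ⟨e.2, hd ▸ he⟩).elim, .inl rfl⟩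
  choose old h1 h2 using this
  exact ⟨old, fun e he => h1 _ e he rfl, h2⟩

/-- Finitely many data are selected and labelled with exactly the demands below `K` that are met,
now and at the next position. -/
theorem exists_valid {K : ℕ} (hK : 0 < K) {s : List ℕ} {x : Fin k × D} {u : List (Fin k × D)}
    (hs : ∀ m ∈ s, m < 2 ^ K) (h : Realizes x u s) : ∃ H ∈ candidates K (s.length + K + 1),
      Valid k K x.1 (!u.isEmpty) s H ∧ ∀ y u', u = y :: u' → Realizes y u' (H.map Item.new) := by
  classical
  obtain ⟨z, rfl, hsort, hm⟩ := h
  obtain ⟨cur, new, hex⟩ := exists_exact K x u (pastData z)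
  obtain ⟨old, hold, hold'⟩ := exists_old hsort
  obtain ⟨W, hW⟩ := exists_witness x u (pastData z)
  -- The current datum, the data of the configuration, and one `existsGe` witness for each formula
  -- number below `K`: this gives the bound `s.length + K + 1`.
  let S : Finset D := insert x.2 ((z.map Prod.fst).toFinset ∪ (Finset.range K).image W)
  obtain ⟨V, hV, hVS, hVn⟩ : ∃ V : List D, V.Pairwise (· < ·) ∧ (∀ d, d ∈ V ↔ d ∈ S) ∧
      V.length ≤ (z.map Prod.snd).length + K + 1 := by
    refine ⟨S.sort, S.sortedLT_sort.pairwise, fun d => Finset.mem_sort _, ?_⟩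
    rw [Finset.length_sort]
    refine (Finset.card_insert_le _ _).trans (Nat.succ_le_succ ((Finset.card_union_le _ _).trans ?_))
    refine Nat.add_le_add ((List.toFinset_card_le _).trans (by simp)) ?_
    exact Finset.card_image_le.trans (by simp)
  have hxV : x.2 ∈ V := (hVS _).2 (Finset.mem_insert_self _ _)
  have hzV : ∀ e ∈ z, e.1 ∈ V := fun e he => (hVS _).2 (Finset.mem_insert_of_mem
    (Finset.mem_union_left _ (List.mem_toFinset.2 (List.mem_map_of_mem he))))
  have hWV : ∀ f < K, W f ∈ V := fun f hf => (hVS _).2 (Finset.mem_insert_of_mem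
    (Finset.mem_union_right _ (Finset.mem_image_of_mem _ (Finset.mem_range.2 hf))))
  have hold_lt : ∀ d, old d < 2 ^ K := fun d => (hold' d).elim
    (fun h => by rw [h]; positivity) fun h => hs _ (List.mem_map_of_mem h)
  refine ⟨V.map fun d => (placeOf x.2 d, old d, cur d, new d),
    mem_candidates_of_sorted hV hxV hVn hold_lt hex.cur_lt hex.new_lt,
    ⟨mem_allSublists.2 ?_, ?_⟩, ?_⟩
  · have h1 : (z.map Prod.fst).Sublist V := by
      have hz : (z.map Prod.fst).Pairwise (· < ·) := List.pairwise_map.2 hsort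
      refine List.sublist_of_subperm_of_pairwise (r := (· ≤ ·)) (List.subperm_of_subset
        (hz.imp fun h => h.ne) fun d hd => ?_) (hz.imp fun h => h.le) (hV.imp fun h => h.le)
      obtain ⟨e, he, rfl⟩ := List.mem_map.1 hd
      exact hzV e he
    have h2 := h1.map old
    rw [List.map_map, List.map_congr_left (f := old ∘ Prod.fst) (g := Prod.snd) fun e he => hold e he] at h2
    rw [List.map_map]
    exact h2
  · simp only [List.forall_mem_map]
    intro d hd
    refine ⟨fun i hi ho => ?_, fun h1 => ?_, fun hb h0 => ?_, fun f hf hc => ?_⟩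
    · obtain h0 | hz := hold' d
      · simp [Item.old, h0] at ho
      · exact (hex.testBit_cur d i).2 ⟨hi, hm _ hz i ho⟩
    · obtain ⟨h1K, h1⟩ := (hex.testBit_cur d 1).1 h1
      obtain h1 | h1 := List.mem_cons.1 h1
      · exact .inl (placeOf_eq_one.2 h1)
      · cases u with
        | nil => simp at h1
        | cons y u => exact .inr ⟨rfl, (hex.testBit_new y u rfl d 1).2 ⟨h1K, h1⟩⟩
    · cases u with
      | nil => simp at hb
      | cons y u =>
        refine (hex.testBit_new y u rfl d 0).2 ⟨hK, ?_⟩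
        exact h0.elim (fun h0 => .inr ((hex.testBit_cur d 0).1 h0).2) fun h1 =>
          .inl (placeOf_eq_one.1 h1)
    · obtain ⟨φ, rfl⟩ := code_surjective (k := k) f
      obtain ⟨hf, hsat⟩ := (hex.hasCode_cur φ d).1 hc
      exact (localCode_code φ).2 (local_of_exact hex rfl (fun φ hφ e he hs =>
        ⟨_, hWV _ hφ, hW φ e he hs⟩) φ d hf hsat)
  · rintro y u rfl
    -- The next labels were computed for the past on the right; it is recovered in full because the
    -- selection keeps `x.2` and all data of `z`.
    have hpast : pastData (V.map fun d => (d, new d)) = insert x.2 (pastData z) := by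
      ext d
      constructor
      · rintro ⟨m, hm, h0⟩
        obtain ⟨e, he, heq⟩ := List.mem_map.1 hm
        cases heq
        exact ((hex.testBit_new y u rfl d 0).1 h0).2
      · intro hd
        refine ⟨_, List.mem_map_of_mem ?_, (hex.testBit_new y u rfl d 0).2 ⟨hK, hd⟩⟩
        obtain rfl | ⟨m, hm, -⟩ := hd
        exacts [hxV, hzV _ hm]
    refine ⟨V.map fun d => (d, new d), by simp [Item.new], List.pairwise_map.2 hV, ?_⟩
    rw [hpast]
    simp only [List.forall_mem_map]
    exact fun d _ i hi => ((hex.testBit_new y u rfl d i).1 hi).2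

end Complete

end OrdLTL
namespace OrdLTL

/-! ### Certificates for satisfiability and unsatisfiability -/

section Certificates

/-- A bound for the bits of the labels in the search for a model of the formula with number `f`. -/
def width (k f : ℕ) : ℕ := 2 * k + 4 + 9 * f + 3

/-- The configuration that demands the formula with number `f`, after storing the current datum. -/
def start (k f : ℕ) : List ℕ := [2 ^ (2 * k + 4 + 9 * f + 2)]

/-- The candidates for the items at a position described by the configuration `s`. -/
def stepCandidates (k f : ℕ) (s : List ℕ) : List (List Item) :=
  candidates (width k f) (s.length + width k f + 1)

/-- The configurations in `Z` are realizable, as shown by ranks that decrease along the word. -/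
def SatCert (k f : ℕ) (Z : List (ℕ × List ℕ)) : Prop :=
  (∃ e ∈ Z, e.2 = start k f) ∧ ∀ e ∈ Z, ∃ a < k, ∃ H ∈ stepCandidates k f e.2,
    Valid k (width k f) a false e.2 H ∨ Valid k (width k f) a true e.2 H ∧
      ∃ e' ∈ Z, e'.1 < e.1 ∧ e'.2 = H.map Item.new

/-- The configurations with a sublist in `S` are closed under taking steps, and no word ends at one
of them. -/
def UnsatCert (k f : ℕ) (S : List (List ℕ)) : Prop :=
  start k f ∈ S ∧ ∀ s ∈ S, (∀ m ∈ s, m < 2 ^ width k f) ∧ ∀ a < k, ∀ H ∈ stepCandidates k f s,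
    ¬ Valid k (width k f) a false s H ∧
      (Valid k (width k f) a true s H → ∃ s' ∈ S, s' ∈ allSublists (H.map Item.new))

variable {k : ℕ} {D : Type*} [LinearOrder D]

/-- The exponent in `start` is `code (freeze φ) + 2`. Truth of `freeze φ` does not depend on the
register, so the datum carrying the label is irrelevant. -/
theorem satisfiable_iff_realizes (φ : OrdLTL (Fin k)) : Satisfiable D φ ↔
    ∃ (x : Fin k × D) (u : List (Fin k × D)), Realizes x u (start k φ.code) := by
  rw [satisfiable_iff_sat]
  refine exists_congr fun x => exists_congr fun u => ⟨fun h => ?_, fun h => ?_⟩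
  · refine ⟨[(x.2, 2 ^ (2 * k + 4 + 9 * φ.code + 2))], rfl, List.pairwise_singleton _ _, ?_⟩
    intro e he b hb
    obtain rfl := List.mem_singleton.1 he
    have hp : pastData [(x.2, 2 ^ (2 * k + 4 + 9 * φ.code + 2))] = ∅ := by
      refine Set.eq_empty_of_forall_notMem ?_
      rintro d ⟨m, hm, h0⟩
      cases List.mem_singleton.1 hm
      rw [Nat.testBit_two_pow] at h0
      simp at h0
    rw [Nat.testBit_two_pow, decide_eq_true_eq] at hb
    rw [hp, ← hb]
    intro ψ hψ
    obtain rfl : ψ = freeze φ := code_injective (by rw [hψ, code])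
    exact h
  · obtain ⟨z, hz, -, hm⟩ := h
    obtain ⟨⟨d, m⟩, z', rfl, rfl, hz'⟩ := List.map_eq_cons_iff.1 hz
    have := hm _ List.mem_cons_self (2 * k + 4 + 9 * φ.code + 2) (by simp) (freeze φ) (by rw [code])
    exact Sat.anti φ _ _ _ _ _ (Set.empty_subset _) this

theorem lt_of_mem_start {k f : ℕ} : ∀ m ∈ start k f, m < 2 ^ width k f := by
  intro m hm
  rw [List.mem_singleton.1 hm, width]
  exact Nat.pow_lt_pow_right (by norm_num) (by omega)

theorem lt_of_mem_new {f : ℕ} {s : List ℕ} {H : List Item} (hH : H ∈ stepCandidates k f s) :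
    ∀ m ∈ H.map Item.new, m < 2 ^ width k f := by
  simp only [List.forall_mem_map]
  exact fun q hq => (lt_of_mem_candidates hH hq).2.2

theorem exists_step {f : ℕ} {s : List ℕ} {x : Fin k × D} {u : List (Fin k × D)}
    (hs : ∀ m ∈ s, m < 2 ^ width k f) (h : Realizes x u s) : ∃ H ∈ stepCandidates k f s,
      Valid k (width k f) x.1 (!u.isEmpty) s H ∧
        ∀ y u', u = y :: u' → Realizes y u' (H.map Item.new) :=
  exists_valid (by rw [width]; omega) hs h

/-- The configurations met along the word form the certificate, each ranked by the number of
positions still to follow. -/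
theorem exists_satCert_of_realizes {f : ℕ} (u : List (Fin k × D)) : ∀ (x : Fin k × D) (s : List ℕ),
    (∀ m ∈ s, m < 2 ^ width k f) → Realizes x u s → ∃ Z : List (ℕ × List ℕ),
      (u.length, s) ∈ Z ∧ ∀ e ∈ Z, ∃ a < k, ∃ H ∈ stepCandidates k f e.2,
        Valid k (width k f) a false e.2 H ∨ Valid k (width k f) a true e.2 H ∧
          ∃ e' ∈ Z, e'.1 < e.1 ∧ e'.2 = H.map Item.new := by
  induction u with
  | nil =>
    intro x s hs h
    obtain ⟨H, hH, hv, -⟩ := exists_step hs h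
    refine ⟨[(0, s)], by simp, fun e he => ?_⟩
    obtain rfl := List.mem_singleton.1 he
    exact ⟨x.1, x.1.isLt, H, hH, .inl hv⟩
  | cons y u ih =>
    intro x s hs h
    obtain ⟨H, hH, hv, hr⟩ := exists_step hs h
    obtain ⟨Z, hZ, hZ'⟩ := ih y _ (lt_of_mem_new hH) (hr y u rfl)
    refine ⟨((y :: u).length, s) :: Z, List.mem_cons_self, fun e he => ?_⟩
    obtain rfl | he := List.mem_cons.1 he
    · exact ⟨x.1, x.1.isLt, H, hH, .inr ⟨hv, _, List.mem_cons_of_mem _ hZ, by simp, rfl⟩⟩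
    · obtain ⟨a, ha, H, hH, h⟩ := hZ' e he
      exact ⟨a, ha, H, hH, h.imp_right fun ⟨hv, e', he', h⟩ =>
        ⟨hv, e', List.mem_cons_of_mem _ he', h⟩⟩

theorem SatCert.realizes [Infinite D] {f : ℕ} {Z : List (ℕ × List ℕ)} (h : SatCert k f Z) (r : ℕ) :
    ∀ s, (r, s) ∈ Z → ∃ (x : Fin k × D) (u : List (Fin k × D)), Realizes x u s := by
  induction r using Nat.strong_induction_on with
  | _ r ih =>
    intro s hs
    obtain ⟨a, ha, H, hH, hv | ⟨hv, ⟨r', s'⟩, he', hr, rfl⟩⟩ := h.2 _ hs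
    · obtain ⟨d, hd⟩ := realizes_of_valid_false (D := D) (a := ⟨a, ha⟩) hH hv
      exact ⟨_, _, hd⟩
    · obtain ⟨y, u, hy⟩ := ih r' hr _ he'
      obtain ⟨d, hd⟩ := realizes_of_valid_true (a := ⟨a, ha⟩) hH hv hy
      exact ⟨_, _, hd⟩

theorem satisfiable_iff_satCert (D : Type*) [LinearOrder D] [Infinite D] (φ : OrdLTL (Fin k)) :
    Satisfiable D φ ↔ ∃ Z, SatCert k φ.code Z := by
  rw [satisfiable_iff_realizes]
  constructor
  · rintro ⟨x, u, h⟩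
    obtain ⟨Z, hZ, hZ'⟩ := exists_satCert_of_realizes u x _ lt_of_mem_start h
    exact ⟨Z, ⟨_, hZ, rfl⟩, hZ'⟩
  · rintro ⟨Z, hZ⟩
    obtain ⟨⟨r, s⟩, he, rfl⟩ := hZ.1
    exact hZ.realizes r _ he

/-- A realizing word leads to next labels with a sublist in `S`, realized by the shorter rest of the
word. This continues down to a one-letter word, which is excluded. -/
theorem UnsatCert.not_realizes {f : ℕ} {S : List (List ℕ)} (h : UnsatCert k f S)
    (u : List (Fin k × D)) : ∀ x : Fin k × D, ∀ s ∈ S, ¬ Realizes x u s := by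
  induction u with
  | nil =>
    intro x s hs hr
    obtain ⟨hlt, hstep⟩ := h.2 s hs
    obtain ⟨H, hH, hv, -⟩ := exists_step hlt hr
    exact (hstep x.1 x.1.isLt H hH).1 hv
  | cons y u ih =>
    intro x s hs hr
    obtain ⟨hlt, hstep⟩ := h.2 s hs
    obtain ⟨H, hH, hv, hr'⟩ := exists_step hlt hr
    obtain ⟨s', hs', hsub⟩ := (hstep x.1 x.1.isLt H hH).2 hv
    exact ih y s' hs' ((hr' y u rfl).sublist (mem_allSublists.1 hsub))

/-- Higman's lemma for the sublist order: a set of lists of bounded numbers has a finite basis. -/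
theorem exists_finite_basis (M : ℕ) (U : Set (List ℕ)) (hU : ∀ s ∈ U, ∀ m ∈ s, m < M) :
    ∃ S : List (List ℕ), (∀ s ∈ S, s ∈ U) ∧ ∀ c ∈ U, ∃ s ∈ S, s.Sublist c := by
  by_contra! hcon
  -- If no finite part of `U` is a basis, one can keep choosing elements that have no earlier choice
  -- as a sublist: a bad sequence.
  obtain ⟨g, hg, hg'⟩ := exists_seq_of_forall_finset_exists (· ∈ U)
    (fun s c : List ℕ => ¬ s.Sublist c) fun S hS => by
      obtain ⟨c, hc, h⟩ := hcon S.toList (by simpa using hS)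
      exact ⟨c, hc, by simpa using h⟩
  -- Equality is a well-quasi-order on the finite set of labels, and the order it induces on lists
  -- is the sublist order.
  have hpwo := Set.PartiallyWellOrderedOn.partiallyWellOrderedOn_sublistForall₂ (α := ℕ) (· = ·)
    (Set.finite_lt_nat M).partiallyWellOrderedOn
  obtain ⟨m, n, hmn, h⟩ := hpwo fun n => ⟨g n, hU _ (hg n)⟩
  obtain ⟨l, hl, hl'⟩ := List.sublistForall₂_iff.1 h
  rw [List.forall₂_eq_eq_eq] at hl
  subst hl
  exact hg' m n hmn hl'

/-- The certificate is a finite basis of the unrealizable configurations with bounded labels. By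
soundness, a valid step from an unrealizable configuration leads to an unrealizable one, which lies
above a basis element. -/
theorem not_satisfiable_iff_unsatCert (D : Type*) [LinearOrder D] [Infinite D]
    (φ : OrdLTL (Fin k)) : ¬ Satisfiable D φ ↔ ∃ S, UnsatCert k φ.code S := by
  rw [satisfiable_iff_realizes]
  constructor
  · intro h
    let U : Set (List ℕ) := {s | (∀ m ∈ s, m < 2 ^ width k φ.code) ∧
      ¬ ∃ (x : Fin k × D) (u : List (Fin k × D)), Realizes x u s}
    obtain ⟨S, hS, hS'⟩ := exists_finite_basis _ U fun s hs => hs.1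
    -- The basis may contain only a proper sublist of `start`, so `start` itself is added.
    refine ⟨start k φ.code :: S, List.mem_cons_self, fun s hs => ?_⟩
    have hsU : s ∈ U := by
      obtain rfl | hs := List.mem_cons.1 hs
      exacts [⟨lt_of_mem_start, h⟩, hS s hs]
    refine ⟨hsU.1, fun a ha H hH => ⟨fun hv => ?_, fun hv => ?_⟩⟩
    · obtain ⟨d, hd⟩ := realizes_of_valid_false (D := D) (a := ⟨a, ha⟩) hH hv
      exact hsU.2 ⟨_, _, hd⟩
    · obtain ⟨s', hs', hsub⟩ := hS' (H.map Item.new) ⟨lt_of_mem_new hH, fun ⟨y, u, hy⟩ => by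
        obtain ⟨d, hd⟩ := realizes_of_valid_true (a := ⟨a, ha⟩) hH hv hy
        exact hsU.2 ⟨_, _, hd⟩⟩
      exact ⟨s', List.mem_cons_of_mem _ hs', mem_allSublists.2 hsub⟩
  · rintro ⟨S, hS⟩ ⟨x, u, hr⟩
    exact hS.not_realizes u x _ hS.1 hr

end Certificates

end OrdLTL

/-! ### Closure properties of primitive recursive predicates -/

section Computability

open Primrec

variable {α β σ : Type*} [Primcodable α] [Primcodable β] [Primcodable σ]

theorem PrimrecPred.imp {p q : α → Prop} (hp : PrimrecPred p) (hq : PrimrecPred q) :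
    PrimrecPred fun a => p a → q a := by
  classical exact (hp.not.or hq).of_eq fun a => imp_iff_not_or.symm

theorem PrimrecPred.exists_mem {L : α → List β} {p : α → β → Prop} (hL : Primrec L)
    (hp : PrimrecPred fun y : α × β => p y.1 y.2) : PrimrecPred fun a => ∃ b ∈ L a, p a b :=
  (PrimrecRel.exists_mem_list (R := fun b a => p a b) (hp.comp (snd.pair fst))).comp hL .id

theorem PrimrecPred.forall_mem {L : α → List β} {p : α → β → Prop} (hL : Primrec L)
    (hp : PrimrecPred fun y : α × β => p y.1 y.2) : PrimrecPred fun a => ∀ b ∈ L a, p a b :=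
  (PrimrecRel.forall_mem_list (R := fun b a => p a b) (hp.comp (snd.pair fst))).comp hL .id

theorem PrimrecPred.exists_lt_comp {n : α → ℕ} {p : α → ℕ → Prop} (hn : Primrec n)
    (hp : PrimrecPred fun y : α × ℕ => p y.1 y.2) : PrimrecPred fun a => ∃ b < n a, p a b :=
  (PrimrecPred.exists_mem (list_range.comp hn) hp).of_eq fun a => by simp

theorem PrimrecPred.forall_lt_comp {n : α → ℕ} {p : α → ℕ → Prop} (hn : Primrec n)
    (hp : PrimrecPred fun y : α × ℕ => p y.1 y.2) : PrimrecPred fun a => ∀ b < n a, p a b :=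
  (PrimrecPred.forall_mem (list_range.comp hn) hp).of_eq fun a => by simp

theorem Primrec.nat_pow {f g : α → ℕ} (hf : Primrec f) (hg : Primrec g) :
    Primrec fun a => f a ^ g a :=
  (Primrec₂.unpaired'.1 Nat.Primrec.pow).comp hf hg

theorem PrimrecPred.testBit {f g : α → ℕ} (hf : Primrec f) (hg : Primrec g) :
    PrimrecPred fun a => (f a).testBit (g a) = true :=
  (Primrec.eq.comp (nat_mod.comp (nat_div.comp hf (Primrec.nat_pow (.const 2) hg)) (.const 2))
    (.const 1)).of_eq fun a => by simp [Nat.testBit_eq_decide_div_mod_eq]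

/-- The existence of a certificate that is checked by a primitive recursive predicate is recursively
enumerable. -/
theorem PrimrecPred.re_exists {p : α → β → Prop} (hp : PrimrecPred fun y : α × β => p y.1 y.2) :
    REPred fun a => ∃ b, p a b := by
  classical
  -- Numbers that decode to nothing give an empty list, so an unbounded search over all numbers
  -- passes over them.
  have h : PrimrecPred fun y : α × ℕ => ∃ b ∈ (Encodable.decode (α := β) y.2).toList, p y.1 b :=
    PrimrecPred.exists_mem (optionToList.comp (Primrec.decode.comp snd))
      (hp.comp ((fst.comp fst).pair snd))
  refine (Partrec.dom_re (f := fun a : α => Nat.rfind fun n => Part.some (decide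
    (∃ b ∈ (Encodable.decode (α := β) n).toList, p a b)))
    (Partrec.rfind h.decide.to_comp.partrec)).of_eq fun a => ?_
  refine Nat.rfind_dom'.trans ?_
  simp only [Part.mem_some_iff, true_eq_decide_iff, Option.mem_toList, Part.some_dom, implies_true,
    and_true]
  constructor
  · rintro ⟨n, b, -, hb⟩
    exact ⟨b, hb⟩
  · rintro ⟨b, hb⟩
    exact ⟨Encodable.encode b, b, Encodable.encodek b, hb⟩

end Computability

/-! ### Primitive recursiveness of the certificate checks -/

namespace OrdLTL

open Primrec

variable {α : Type*} [Primcodable α]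

theorem Item.primrec_place : Primrec Item.place := fst
theorem Item.primrec_old : Primrec Item.old := fst.comp snd
theorem Item.primrec_cur : Primrec Item.cur := fst.comp (snd.comp snd)
theorem Item.primrec_new : Primrec Item.new := snd.comp (snd.comp snd)

theorem primrecPred_hasCode {m f : α → ℕ} (hm : Primrec m) (hf : Primrec f) :
    PrimrecPred fun x => HasCode (m x) (f x) :=
  PrimrecPred.testBit hm (nat_add.comp hf (.const 2))

theorem primrecPred_localCompound {b : α → Bool} {H : α → List Item} {q : α → Item}
    {f m r : α → ℕ} (hb : Primrec b) (hH : Primrec H) (hq : Primrec q) (hf : Primrec f)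
    (hm : Primrec m) (hr : Primrec r) :
    PrimrecPred fun x => LocalCompound (b x) (H x) (q x) (f x) (m x) (r x) := by
  have hr (n : ℕ) : PrimrecPred fun x => r x = n := Primrec.eq.comp hr (.const n)
  have hb' (v : Bool) : PrimrecPred fun x => b x = v := Primrec.eq.comp hb (.const v)
  have hcur := Item.primrec_cur.comp hq
  have hnew := Item.primrec_new.comp hq
  have hm' : Primrec fun y : α × Item => m y.1 := hm.comp fst
  have hpl : PrimrecPred fun y : α × Item => y.2.place = 1 :=
    Primrec.eq.comp (Item.primrec_place.comp snd) (.const 1)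
  have hpc : PrimrecPred fun y : α × Item => HasCode y.2.cur (m y.1) :=
    primrecPred_hasCode (Item.primrec_cur.comp snd) hm'
  have hbit (i : ℕ) : PrimrecPred fun y : α × Item => y.2.cur.testBit i = true :=
    PrimrecPred.testBit (Item.primrec_cur.comp snd) (.const i)
  have h1 := primrecPred_hasCode hcur (fst.comp (Primrec.unpair.comp hm))
  have h2 := primrecPred_hasCode hcur (snd.comp (Primrec.unpair.comp hm))
  have h3 := primrecPred_hasCode hnew hf
  have h4 := primrecPred_hasCode hnew hm
  exact ((hr 0).imp (.forall_mem hH (hpl.imp hpc))).and <|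
    ((hr 1).imp ((hb' true).and h4)).and <|
    ((hr 2).imp ((hb' false).or h4)).and <|
    ((hr 3).imp (.exists_mem hH ((hbit 1).and hpc))).and <|
    ((hr 4).imp (.forall_mem hH (((hbit 0).or hpl).imp hpc))).and <|
    ((hr 5).imp (h1.or (h2.and ((hb' true).and h3)))).and <|
    ((hr 6).imp (h1.and (h2.or ((hb' false).or h3)))).and <|
    ((hr 7).imp (h1.and h2)).and ((hr 8).imp (h1.or h2))

theorem primrecPred_localCode {k a f : α → ℕ} {b : α → Bool} {H : α → List Item} {q : α → Item}
    (hk : Primrec k) (ha : Primrec a) (hb : Primrec b) (hH : Primrec H) (hq : Primrec q)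
    (hf : Primrec f) :
    PrimrecPred fun x => LocalCode (k x) (a x) (b x) (H x) (q x) (f x) := by
  have h2k (n : ℕ) : Primrec fun x => 2 * k x + n :=
    nat_add.comp (nat_mul.comp (.const 2) hk) (.const n)
  have heq (n : ℕ) : PrimrecPred fun x => f x = 2 * k x + n := Primrec.eq.comp hf (h2k n)
  have hpl (n : ℕ) : PrimrecPred fun x => (q x).place = n :=
    Primrec.eq.comp (Item.primrec_place.comp hq) (.const n)
  have hsub := nat_sub.comp hf (h2k 4)
  exact ((nat_lt.comp hf hk).imp (Primrec.eq.comp hf ha)).and <|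
    ((nat_le.comp hk hf).imp ((nat_lt.comp hf (h2k 0)).imp
      (PrimrecPred.not (Primrec.eq.comp (nat_sub.comp hf hk) ha)))).and <|
    ((heq 0).imp (hpl 1)).and <| ((heq 1).imp (hpl 1).not).and <| ((heq 2).imp (hpl 2)).and <|
    ((heq 3).imp (hpl 0)).and <| (nat_le.comp (h2k 4) hf).imp <|
    primrecPred_localCompound hb hH hq hf (nat_div.comp hsub (.const 9)) (nat_mod.comp hsub (.const 9))

theorem primrec_allSublists : Primrec allSublists :=
  list_foldr .id (.const [[]]) (Primrec.to₂ (list_append.comp (snd.comp snd)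
    (list_map (snd.comp snd) (Primrec.to₂ (list_cons.comp (fst.comp (snd.comp fst)) snd)))))

theorem primrecPred_mem_allSublists {s l : α → List ℕ} (hs : Primrec s) (hl : Primrec l) :
    PrimrecPred fun x => s x ∈ allSublists (l x) :=
  (PrimrecPred.exists_mem (p := fun x r => r = s x) (primrec_allSublists.comp hl)
    (Primrec.eq.comp snd (hs.comp fst))).of_eq fun x => by simp

theorem primrecPred_valid {k K a : α → ℕ} {b : α → Bool} {s : α → List ℕ} {H : α → List Item}
    (hk : Primrec k) (hK : Primrec K) (ha : Primrec a) (hb : Primrec b) (hs : Primrec s)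
    (hH : Primrec H) : PrimrecPred fun x => Valid (k x) (K x) (a x) (b x) (s x) (H x) := by
  have hbit {γ : Type _} [Primcodable γ] {m : γ → ℕ} (hm : Primrec m) (i : ℕ) :
      PrimrecPred fun y => (m y).testBit i = true := PrimrecPred.testBit hm (.const i)
  have hcur : Primrec fun y : α × Item => y.2.cur := Item.primrec_cur.comp snd
  have hnew : Primrec fun y : α × Item => y.2.new := Item.primrec_new.comp snd
  have hold : Primrec fun y : α × Item => y.2.old := Item.primrec_old.comp snd
  have hpl : PrimrecPred fun y : α × Item => y.2.place = 1 :=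
    Primrec.eq.comp (Item.primrec_place.comp snd) (.const 1)
  have hb' : PrimrecPred fun y : α × Item => b y.1 = true :=
    Primrec.eq.comp (hb.comp fst) (.const true)
  refine (primrecPred_mem_allSublists hs
    (list_map hH (Primrec.to₂ (Item.primrec_old.comp snd)))).and (.forall_mem hH ?_)
  refine (PrimrecPred.forall_lt_comp (hK.comp fst) ?_).and <|
    ((hbit hcur 1).imp (hpl.or (hb'.and (hbit hnew 1)))).and <|
    (hb'.imp (((hbit hcur 0).or hpl).imp (hbit hnew 0))).and <|
    PrimrecPred.forall_lt_comp (hK.comp fst) ?_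
  · exact (PrimrecPred.testBit (hold.comp fst) snd).imp (PrimrecPred.testBit (hcur.comp fst) snd)
  · have h : Primrec fun y : (α × Item) × ℕ => y.1.1 := fst.comp fst
    exact (primrecPred_hasCode (hcur.comp fst) snd).imp (primrecPred_localCode (hk.comp h)
      (ha.comp h) (hb.comp h) (hH.comp h) (snd.comp fst) snd)

theorem primrec_itemList (t : ℕ) : Primrec (itemList t) := by
  have hr {γ : Type} [Primcodable γ] {K : γ → ℕ} (hK : Primrec K) :
      Primrec fun y => List.range (2 ^ K y) :=
    list_range.comp (Primrec.nat_pow (.const 2) hK)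
  have h1 : Primrec fun y : (ℕ × ℕ) × ℕ =>
      (List.range (2 ^ y.1.1)).map fun n => ((t, y.1.2, y.2, n) : Item) :=
    list_map (hr (fst.comp fst)) (Primrec.to₂ ((Primrec.const t).pair
      ((snd.comp (fst.comp fst)).pair ((snd.comp fst).pair snd))))
  have h2 : Primrec fun y : ℕ × ℕ => (List.range (2 ^ y.1)).flatMap fun c =>
      (List.range (2 ^ y.1)).map fun n => ((t, y.2, c, n) : Item) :=
    list_flatMap (hr fst) (Primrec.to₂ h1)
  exact list_flatMap (hr .id) (Primrec.to₂ h2)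

theorem primrec_listsUpTo {β : Type*} [Primcodable β] {L : α → List β} {n : α → ℕ}
    (hL : Primrec L) (hn : Primrec n) : Primrec fun x => listsUpTo (L x) (n x) := by
  refine (nat_rec' (h := fun x (y : ℕ × List (List β)) =>
    [] :: (L x).flatMap fun e => y.2.map fun l => e :: l) hn (Primrec.const [[]]) ?_).of_eq ?_
  · refine Primrec.to₂ (list_cons.comp (.const []) (list_flatMap (hL.comp fst) (Primrec.to₂
      (list_map (snd.comp (snd.comp fst)) (Primrec.to₂ (list_cons.comp (snd.comp fst) snd))))))
  · intro x
    induction n x with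
    | zero => rfl
    | succ m ih => simp only [listsUpTo, ← ih]

theorem primrec_candidates {K n : α → ℕ} (hK : Primrec K) (hn : Primrec n) :
    Primrec fun x => candidates (K x) (n x) := by
  have h1 : Primrec fun y : (α × List Item) × Item =>
      (listsUpTo (itemList 2 (K y.1.1)) (n y.1.1)).map fun r => y.1.2 ++ y.2 :: r :=
    list_map (primrec_listsUpTo ((primrec_itemList 2).comp (hK.comp (fst.comp fst)))
      (hn.comp (fst.comp fst))) (Primrec.to₂ (list_append.comp (snd.comp (fst.comp fst))
        (list_cons.comp (snd.comp fst) snd)))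
  have h2 : Primrec fun y : α × List Item => (itemList 1 (K y.1)).flatMap fun c =>
      (listsUpTo (itemList 2 (K y.1)) (n y.1)).map fun r => y.2 ++ c :: r :=
    list_flatMap ((primrec_itemList 1).comp (hK.comp fst)) (Primrec.to₂ h1)
  exact list_flatMap (primrec_listsUpTo ((primrec_itemList 0).comp hK) hn) (Primrec.to₂ h2)

theorem primrec_formulaNumber (n : ℕ) {k f : α → ℕ} (hk : Primrec k) (hf : Primrec f) :
    Primrec fun x => 2 * k x + 4 + 9 * f x + n :=
  nat_add.comp (nat_add.comp (nat_add.comp (nat_mul.comp (.const 2) hk) (.const 4))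
    (nat_mul.comp (.const 9) hf)) (.const n)

theorem primrec_width {k f : α → ℕ} (hk : Primrec k) (hf : Primrec f) :
    Primrec fun x => width (k x) (f x) :=
  primrec_formulaNumber 3 hk hf

theorem primrec_start {k f : α → ℕ} (hk : Primrec k) (hf : Primrec f) :
    Primrec fun x => start (k x) (f x) :=
  list_cons.comp (Primrec.nat_pow (.const 2) (primrec_formulaNumber 2 hk hf)) (.const [])

theorem primrec_stepCandidates {k f : α → ℕ} {s : α → List ℕ} (hk : Primrec k) (hf : Primrec f)
    (hs : Primrec s) : Primrec fun x => stepCandidates (k x) (f x) (s x) :=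
  primrec_candidates (primrec_width hk hf) (nat_add.comp (nat_add.comp
    (list_length.comp hs) (primrec_width hk hf)) (.const 1))

theorem primrecPred_valid_step (b : Bool) :
    PrimrecPred fun y : (((ℕ × ℕ) × List ℕ) × ℕ) × List Item =>
      Valid y.1.1.1.1 (width y.1.1.1.1 y.1.1.1.2) y.1.2 b y.1.1.2 y.2 := by
  have h1 : Primrec fun y : (((ℕ × ℕ) × List ℕ) × ℕ) × List Item => y.1.1.1 :=
    fst.comp (fst.comp fst)
  exact primrecPred_valid (fst.comp h1) (primrec_width (fst.comp h1) (snd.comp h1)) (snd.comp fst)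
    (.const b) (snd.comp (fst.comp fst)) snd

theorem primrec_map_new : Primrec (List.map Item.new) :=
  list_map .id (Primrec.to₂ (Item.primrec_new.comp snd))

theorem primrecPred_satCert : PrimrecPred fun x : (ℕ × ℕ) × List (ℕ × List ℕ) =>
    SatCert x.1.1 x.1.2 x.2 := by
  let E := ((((ℕ × ℕ) × List (ℕ × List ℕ)) × ℕ × List ℕ) × ℕ) × List Item
  have hv (b : Bool) : PrimrecPred fun y : E => Valid y.1.1.1.1.1
      (width y.1.1.1.1.1 y.1.1.1.1.2) y.1.2 b y.1.1.2.2 y.2 :=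
    (primrecPred_valid_step b).comp (((((fst.comp (fst.comp (fst.comp fst))).pair
      (snd.comp (snd.comp (fst.comp fst)))).pair (snd.comp fst))).pair snd)
  have hlt : PrimrecPred fun y : E × ℕ × List ℕ => y.2.1 < y.1.1.1.2.1 :=
    nat_lt.comp (fst.comp snd) (fst.comp (snd.comp (fst.comp (fst.comp fst))))
  have heq : PrimrecPred fun y : E × ℕ × List ℕ => y.2.2 = y.1.2.map Item.new :=
    Primrec.eq.comp (snd.comp snd) (primrec_map_new.comp (snd.comp fst))
  have hex : PrimrecPred fun y : E => ∃ e ∈ y.1.1.1.2, e.1 < y.1.1.2.1 ∧ e.2 = y.2.map Item.new :=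
    .exists_mem (snd.comp (fst.comp (fst.comp fst))) (hlt.and heq)
  have hstep := (hv false).or ((hv true).and hex)
  have hst : PrimrecPred fun x : (ℕ × ℕ) × List (ℕ × List ℕ) =>
      ∃ e ∈ x.2, e.2 = start x.1.1 x.1.2 :=
    .exists_mem snd (Primrec.eq.comp (snd.comp snd)
      (primrec_start (fst.comp (fst.comp fst)) (snd.comp (fst.comp fst))))
  have hcand : Primrec fun y : (((ℕ × ℕ) × List (ℕ × List ℕ)) × ℕ × List ℕ) × ℕ =>
      stepCandidates y.1.1.1.1 y.1.1.1.2 y.1.2.2 :=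
    primrec_stepCandidates (fst.comp (fst.comp (fst.comp fst)))
      (snd.comp (fst.comp (fst.comp fst))) (snd.comp (snd.comp fst))
  have hk : Primrec fun y : ((ℕ × ℕ) × List (ℕ × List ℕ)) × ℕ × List ℕ => y.1.1.1 :=
    fst.comp (fst.comp fst)
  exact hst.and (.forall_mem snd (.exists_lt_comp hk (.exists_mem hcand hstep)))

theorem primrecPred_unsatCert : PrimrecPred fun x : (ℕ × ℕ) × List (List ℕ) =>
    UnsatCert x.1.1 x.1.2 x.2 := by
  let E := ((((ℕ × ℕ) × List (List ℕ)) × List ℕ) × ℕ) × List Item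
  have hv (b : Bool) : PrimrecPred fun y : E => Valid y.1.1.1.1.1
      (width y.1.1.1.1.1 y.1.1.1.1.2) y.1.2 b y.1.1.2 y.2 :=
    (primrecPred_valid_step b).comp (((((fst.comp (fst.comp (fst.comp fst))).pair
      (snd.comp (fst.comp fst))).pair (snd.comp fst))).pair snd)
  have hex : PrimrecPred fun y : E =>
      ∃ s ∈ y.1.1.1.2, s ∈ allSublists (y.2.map Item.new) :=
    .exists_mem (snd.comp (fst.comp (fst.comp fst)))
      (primrecPred_mem_allSublists snd (primrec_map_new.comp (snd.comp fst)))
  have hstep := (hv false).not.and ((hv true).imp hex)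
  have hst : PrimrecPred fun x : (ℕ × ℕ) × List (List ℕ) => start x.1.1 x.1.2 ∈ x.2 :=
    (PrimrecPred.exists_mem (p := fun (x : (ℕ × ℕ) × List (List ℕ)) r => r = start x.1.1 x.1.2)
      snd (Primrec.eq.comp snd
        (primrec_start (fst.comp (fst.comp fst)) (snd.comp (fst.comp fst))))).of_eq
      fun x => by simp
  have hbound : PrimrecPred fun y : ((ℕ × ℕ) × List (List ℕ)) × List ℕ =>
      ∀ m ∈ y.2, m < 2 ^ width y.1.1.1 y.1.1.2 :=
    .forall_mem snd (nat_lt.comp snd (Primrec.nat_pow (.const 2)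
      (primrec_width (fst.comp (fst.comp (fst.comp fst))) (snd.comp (fst.comp (fst.comp fst))))))
  have hcand : Primrec fun y : (((ℕ × ℕ) × List (List ℕ)) × List ℕ) × ℕ =>
      stepCandidates y.1.1.1.1 y.1.1.1.2 y.1.2 :=
    primrec_stepCandidates (fst.comp (fst.comp (fst.comp fst)))
      (snd.comp (fst.comp (fst.comp fst))) (snd.comp fst)
  have hk : Primrec fun y : ((ℕ × ℕ) × List (List ℕ)) × List ℕ => y.1.1.1 :=
    fst.comp (fst.comp fst)
  exact hst.and (.forall_mem snd (hbound.and (.forall_lt_comp hk (.forall_mem hcand hstep))))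

/-- The encoding of an instance is already the pairing of these two numbers, so unpairing it
suffices. -/
theorem primrec_pair_code : Primrec fun x : Instance => (x.1, x.2.code) :=
  (Primrec.unpair.comp Primrec.encode).of_eq fun ⟨k, φ⟩ => by
    rw [encode_instance, Nat.unpair_pair]

end OrdLTL

theorem mainTheorem11 (D : Type*) [LinearOrder D] [Infinite D] :
    ComputablePred (fun x : OrdLTL.Instance => OrdLTL.Satisfiable D x.2) := by
  refine ComputablePred.computable_iff_re_compl_re'.2 ⟨?_, ?_⟩
  · refine (PrimrecPred.re_exists (p := fun (x : OrdLTL.Instance) Z =>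
      OrdLTL.SatCert x.1 x.2.code Z) (OrdLTL.primrecPred_satCert.comp
        ((OrdLTL.primrec_pair_code.comp Primrec.fst).pair Primrec.snd))).of_eq fun x => ?_
    exact (OrdLTL.satisfiable_iff_satCert D x.2).symm
  · refine (PrimrecPred.re_exists (p := fun (x : OrdLTL.Instance) S =>
      OrdLTL.UnsatCert x.1 x.2.code S) (OrdLTL.primrecPred_unsatCert.comp
        ((OrdLTL.primrec_pair_code.comp Primrec.fst).pair Primrec.snd))).of_eq fun x => ?_
    exact (OrdLTL.not_satisfiable_iff_unsatCert D x.2).symm
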